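/- Let $c_D>1$ and let $N\ge 2$ be an integer. There are constants $c_1,c_2>0$, depending only on $c_D$ and $N$, such that the following holds. Let $X$ be a complete metric space with a Borel regular outer measure $\mu$ such that every open ball $B(x,r)=\{y\in X: d(x,y)<r\}$, $x\in X$, $0<r<\infty$, satisfies $0<\mu(B(x,r))<\infty$, and such that $\mu(B(x,2r))\le c_D\,\mu(B(y,r))$ whenever $x,y\in X$, $0<r<\infty$ and $B(x,2r)\cap B(y,r)\neq\emptyset$. For a locally integrable $f:X\to\mathbb R$ put $$\|f\|_*=\sup_B \frac1{\mu(B)}\int_B |f-f_B|\,d\mu,\qquad f_B=\frac1{\mu(B)}\int_B f\,d\mu,$$ where the supremum is taken over all open balls $B\subset X$; $f\in \mathrm{BMO}(X)$ means that $f$ is locally integrable and $\|f\|_*<\infty$. Let $\lambda>1$ and let $E_1,\dots,E_N\subset X$ be $\mu$-measurable. (a) If $$\min_{1\le j\le N}\frac{\mu(E_j\cap B)}{\mu(B)}\le c_D^{-4\lambda}\quad\text{for every ball } B\subset X, \tag{1}$$ then there are functions $f_1,\dots,f_N\in \mathrm{BMO}(X)$ such that $$\sum_{j=1}^N f_j(x)=1\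 \text{ and }\ 0\le f_j(x)\le 1 \text{ for all } x\in X,\quad f_j=0\ \ \mu\text{-a.e. on } E_j, \tag{2}$$ and $\|f_j\|_*\le c_1/\lambda$ for every $1\le j\le N$. (b) Conversely, if there are functions $f_1,\dots,f_N\in \mathrm{BMO}(X)$ satisfying (2) and $\|f_j\|_*\le c_2/\lambda$ for every $1\le j\le N$, then (1) holds. -/

import Mathlib

open MeasureTheory Metric
open scoped ENNReal

/-- `μ` is doubling with constant `c`: every ball has positive and finite measure, `c > 1`, and
`μ (B(x, 2r)) ≤ c μ (B(y, r))` whenever `B(x, 2r)` and `B(y, r)` intersect. -/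
structure IsDoublingWith {X : Type*} [MetricSpace X] [MeasurableSpace X]
    (μ : Measure X) (c : ℝ) : Prop where
  one_lt : 1 < c
  ball_pos : ∀ (x : X) (r : ℝ), 0 < r → 0 < μ (ball x r)
  ball_lt_top : ∀ (x : X) (r : ℝ), 0 < r → μ (ball x r) < ∞
  doubling : ∀ (x y : X) (r : ℝ), 0 < r → (ball x (2 * r) ∩ ball y r).Nonempty →
    μ (ball x (2 * r)) ≤ ENNReal.ofReal c * μ (ball y r)

/-- The BMO (semi)norm: the supremum over all open balls `B` of the average over `B` of
`|f - f_B|`, where `f_B` is the average of `f` over `B`. It takes the value `∞` when the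
oscillations are unbounded, and it is meaningful for locally integrable `f`. -/
noncomputable def bmoNorm {X : Type*} [MetricSpace X] [MeasurableSpace X]
    (μ : Measure X) (f : X → ℝ) : ℝ≥0∞ :=
  ⨆ (x : X) (r : ℝ) (_ : 0 < r),
    ⨍⁻ y in ball x r, ‖f y - ⨍ z in ball x r, f z ∂μ‖ₑ ∂μ

/-- `f` belongs to `BMO(X)`: it is locally integrable with finite BMO norm. -/
def MemBMO {X : Type*} [MetricSpace X] [MeasurableSpace X]
    (μ : Measure X) (f : X → ℝ) : Prop :=
  LocallyIntegrable f μ ∧ bmoNorm μ f < ∞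

/-- The density condition: `min_j μ(E_j ∩ B) / μ(B) ≤ c ^ (-4 lam)` for every ball `B`.
(For `N ≥ 1` the infimum over `Fin N` is the minimum of `N` real numbers.) -/
def DensityCondition {X : Type*} [MetricSpace X] [MeasurableSpace X]
    (μ : Measure X) (c lam : ℝ) {N : ℕ} (E : Fin N → Set X) : Prop :=
  ∀ (x : X) (r : ℝ), 0 < r →
    ⨅ j : Fin N, μ.real (E j ∩ ball x r) / μ.real (ball x r) ≤ c ^ (-4 * lam)

/-- The functions `f_j` take values in `[0, 1]`, add up to `1` at every point, and `f_j` vanishes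
almost everywhere on `E_j`. -/
structure IsPartitionVanishingOn {X : Type*} [MeasurableSpace X]
    (μ : Measure X) {N : ℕ} (E : Fin N → Set X) (f : Fin N → X → ℝ) : Prop where
  sum_eq_one : ∀ x, ∑ j, f j x = 1
  nonneg : ∀ j x, 0 ≤ f j x
  le_one : ∀ j x, f j x ≤ 1
  ae_eq_zero : ∀ j, ∀ᵐ x ∂μ, x ∈ E j → f j x = 0

/-!
A partition of unity into functions of small BMO norm, vanishing on prescribed sets, exists if and
only if, up to constants, in every ball one of the sets is exponentially sparse.

**A single tool.** All measure estimates come from the covering principle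
`IsDoublingWith.measure_iUnion_ball_le`: a comparison `ν (B(x, 8t)) ≤ κ ν' (B(x, t))` for the balls
of a family passes to the union of the family. It yields weak type bounds for truncated maximal
functions (`IsDoublingWith.measure_denseBalls_inter_le`) and allows enlarging domains of
integration.

**Small norms imply sparsity.** In a given ball some `f j` has average at least `1 / N`, while it
vanishes on `E j`. Stopping at the first scale at which the averages of `f j` around a point of
`E j` have dropped by a fixed multiple of the BMO norm selects balls filling a small fraction of the
given ball, and one iterates in these balls: `IsDoublingWith.measure_zeros_inter_ball_le`. The
number of iterations is proportional to the reciprocal of the norm. This takes the place of the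
John-Nirenberg inequality.

**Sparsity implies small norms.** With `M = lam / 2`, functions `V j ≥ 0` with sum `M` are
constructed scale by scale, the scale being divided by `16` in each step. The invariant
(`IsAdmissible`) is that the density of `E j` at the current scale is at most a constant times
`c ^ (-4 * V j)`. One step (`pushStep`) pushes `V j` down by at most `1` near the points where the
refined scale would violate the bound, and gives what was removed to functions whose sets are very
sparse at this scale; there are such sets, by the density condition. All cutoffs are Lipschitz at
the current scale, so that each `V j` is Lipschitz at its scale with a constant independent of `M`.

The heart of the matter is that few steps change the functions near a typical point
(`IsPushSequence.sum_measure_changeZone_le`). Between two raises, each push of `V j` requires a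
density of `E j` larger by the factor `c ^ 4` than the previous push did, so pushes are controlled
by a logarithm of a maximal function (`excess`), and the weak type bound gives a geometric series.
After a raise `V j ≤ M`, but `E j` has density at most a constant times `c ^ (-8 * M)`, so the
pushes following a raise contribute at most a constant times `c ^ (-4 * M)` times the measure of the
zone of change, which an induction on the number of scales absorbs.

To start, the sets are truncated to a large ball; the sparsest set in that ball gives a constant
admissible family. Letting the radius grow, a subsequence converges at every scale
(`exists_isScaleFamily`). The limits at the scales `16 ^ (-m)` converge almost everywhere as
`m → ∞`, to functions with mean oscillation bounded independently of `M`, the function with index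
`j` being bounded on `E j` by a constant independent of `M`. Subtracting that constant, taking
positive parts and normalizing the sum to `1` divides the oscillation by `M`
(`IsScaleFamily.exists_partition`). For bounded `lam` a partition into indicator functions suffices.
-/

open Filter Topology Set

/-! ### Powers, doubling and the covering principle -/

section

/-- The power `c ^ t` as an extended nonnegative real. -/
noncomputable def epow (c t : ℝ) : ℝ≥0∞ := ENNReal.ofReal (c ^ t)

namespace epow

variable {c : ℝ}

lemma ne_top (c t : ℝ) : epow c t ≠ ∞ := ENNReal.ofReal_ne_top

lemma pos (hc : 1 < c) (t : ℝ) : 0 < epow c t :=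
  ENNReal.ofReal_pos.2 (Real.rpow_pos_of_pos (by linarith) t)

lemma add (hc : 1 < c) (s t : ℝ) : epow c (s + t) = epow c s * epow c t := by
  unfold epow
  rw [Real.rpow_add (by linarith), ENNReal.ofReal_mul (Real.rpow_nonneg (by linarith) _)]

lemma zero (c : ℝ) : epow c 0 = 1 := by simp [epow]

lemma one (c : ℝ) : epow c 1 = ENNReal.ofReal c := by simp [epow]

lemma mono (hc : 1 < c) {s t : ℝ} (h : s ≤ t) : epow c s ≤ epow c t :=
  ENNReal.ofReal_le_ofReal (Real.rpow_le_rpow_of_exponent_le hc.le h)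

lemma lt_iff (hc : 1 < c) {s t : ℝ} : epow c s < epow c t ↔ s < t := by
  unfold epow
  rw [ENNReal.ofReal_lt_ofReal_iff (Real.rpow_pos_of_pos (by linarith) t),
    Real.rpow_lt_rpow_left_iff hc]

lemma le_iff (hc : 1 < c) {s t : ℝ} : epow c s ≤ epow c t ↔ s ≤ t := by
  rw [← not_lt, lt_iff hc, not_lt]

lemma one_le (hc : 1 < c) {t : ℝ} (h : 0 ≤ t) : 1 ≤ epow c t := by
  rw [← zero c]; exact mono hc h

lemma mul_neg_cancel (hc : 1 < c) (t : ℝ) : epow c t * epow c (-t) = 1 := by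
  rw [← add hc, add_neg_cancel, zero]

lemma neg (hc : 1 < c) (t : ℝ) : epow c (-t) = (epow c t)⁻¹ :=
  ENNReal.eq_inv_of_mul_eq_one_left (by rw [mul_comm]; exact mul_neg_cancel hc t)

lemma le_mul_iff (hc : 1 < c) (t : ℝ) {a b : ℝ≥0∞} : a ≤ epow c t * b ↔ epow c (-t) * a ≤ b := by
  constructor
  · intro h
    calc epow c (-t) * a ≤ epow c (-t) * (epow c t * b) := by gcongr
      _ = b := by rw [← mul_assoc, mul_comm (epow c (-t)), mul_neg_cancel hc, one_mul]
  · intro h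
    calc a = epow c t * (epow c (-t) * a) := by rw [← mul_assoc, mul_neg_cancel hc, one_mul]
      _ ≤ _ := by gcongr

lemma pow_natCast (hc : 1 < c) (t : ℝ) (n : ℕ) : epow c t ^ n = epow c (t * n) := by
  unfold epow
  rw [Real.rpow_mul_natCast (by linarith), ENNReal.ofReal_pow (Real.rpow_nonneg (by linarith) _)]

end epow

namespace IsDoublingWith

variable {X : Type*} [MetricSpace X] [MeasurableSpace X] {μ : Measure X} {c : ℝ}

/-- Iterated doubling: comparison of a ball of radius at most `2 ^ (n + 1) * r` with a ball of
radius `r` whose centre is not too far away. -/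
lemma measure_ball_le (hμ : IsDoublingWith μ c) {x y : X} {r s : ℝ} (hr : 0 < r) (n : ℕ) (p : ℝ)
    (hs : s ≤ 2 ^ (n + 1) * r) (hy : dist x y < 2 ^ (n + 1) * r)
    (hp : (n : ℝ) + 1 = p := by norm_num) :
    μ (ball x s) ≤ epow c p * μ (ball y r) := by
  subst hp
  have hc := hμ.one_lt
  have key : ∀ (m : ℕ) (z : X) (t : ℝ), 0 < t → dist z y < 2 ^ (m + 1) * t →
      μ (ball z (2 ^ (m + 1) * t)) ≤ epow c (m + 1) * μ (ball y t) := by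
    intro m
    induction m with
    | zero =>
      intro z t ht hz
      simp only [zero_add, pow_one, Nat.cast_zero, epow.one] at hz ⊢
      exact hμ.doubling z y t ht ⟨y, by rwa [mem_ball'], mem_ball_self ht⟩
    | succ m ih =>
      intro z t ht hz
      have h1 := hμ.doubling z y (2 ^ (m + 1) * t) (by positivity)
        ⟨y, by rw [mem_ball', ← mul_assoc, ← pow_succ']; exact hz, mem_ball_self (by positivity)⟩
      have h2 := ih y t ht (by rw [dist_self]; positivity)
      rw [← mul_assoc, ← pow_succ'] at h1
      refine h1.trans ?_
      rw [← epow.one, show ((m + 1 : ℕ) : ℝ) + 1 = 1 + ((m : ℝ) + 1) by push_cast; ring,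
        epow.add hc 1, mul_assoc]
      gcongr
  exact (measure_mono (ball_subset_ball hs)).trans (key n x r hr hy)

lemma measure_ball_ne_top (hμ : IsDoublingWith μ c) (x : X) {r : ℝ} (hr : 0 < r) :
    μ (ball x r) ≠ ∞ := (hμ.ball_lt_top x r hr).ne

lemma measure_ball_ne_zero (hμ : IsDoublingWith μ c) (x : X) {r : ℝ} (hr : 0 < r) :
    μ (ball x r) ≠ 0 := (hμ.ball_pos x r hr).ne'

lemma isLocallyFiniteMeasure (hμ : IsDoublingWith μ c) : IsLocallyFiniteMeasure μ :=
  ⟨fun x => ⟨ball x 1, ball_mem_nhds x one_pos, hμ.ball_lt_top x 1 one_pos⟩⟩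

lemma sigmaFinite (hμ : IsDoublingWith μ c) : SigmaFinite μ := by
  rcases isEmpty_or_nonempty X with h | ⟨⟨x₀⟩⟩
  · have : μ = 0 := Measure.eq_zero_of_isEmpty μ
    rw [this]; infer_instance
  · refine ⟨⟨⟨fun n => ball x₀ (n + 1), fun _ => trivial,
      fun n => hμ.ball_lt_top x₀ _ (by positivity), ?_⟩⟩⟩
    refine eq_univ_of_forall fun x => mem_iUnion.2 ?_
    obtain ⟨n, hn⟩ := exists_nat_gt (dist x x₀)
    exact ⟨n, by rw [mem_ball]; linarith⟩

lemma isUnifLocDoublingMeasure (hμ : IsDoublingWith μ c) : IsUnifLocDoublingMeasure μ := by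
  have hc := hμ.one_lt
  refine ⟨⟨(c ^ (2 : ℝ)).toNNReal, ?_⟩⟩
  filter_upwards [self_mem_nhdsWithin] with ε hε x
  rw [mem_Ioi] at hε
  calc μ (closedBall x (2 * ε)) ≤ μ (ball x (4 * ε)) :=
        measure_mono (closedBall_subset_ball (by linarith))
    _ ≤ epow c 2 * μ (ball x ε) :=
        hμ.measure_ball_le hε 1 2 (by norm_num) (by rw [dist_self]; positivity)
    _ ≤ _ := by
        gcongr
        · exact le_rfl
        · exact ball_subset_closedBall

/-- The union of the balls of radius at most `ρ` in which `E` has density at least `s`. It is the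
superlevel set of a truncated maximal function of the indicator of `E`. -/
def _root_.denseBalls (μ : Measure X) (E : Set X) (s : ℝ≥0∞) (ρ : ℝ) : Set X :=
  ⋃ p ∈ {p : X × ℝ | 0 < p.2 ∧ p.2 ≤ ρ ∧ s * μ (ball p.1 p.2) ≤ μ (E ∩ ball p.1 p.2)},
    ball p.1 p.2

lemma _root_.isOpen_denseBalls (E : Set X) (s : ℝ≥0∞) (ρ : ℝ) : IsOpen (denseBalls μ E s ρ) :=
  isOpen_biUnion fun _ _ => isOpen_ball

variable [BorelSpace X]

/-- A doubling space is separable: a maximal separated set carries disjoint balls of positive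
measure, hence is countable. -/
lemma secondCountableTopology (hμ : IsDoublingWith μ c) : SecondCountableTopology X := by
  have := hμ.sigmaFinite
  refine Metric.secondCountable_of_almost_dense_set fun ε hε => ?_
  obtain ⟨u, -, hdisj, hcov⟩ := Vitali.exists_disjoint_subfamily_covering_enlargement_closedBall
    (univ : Set X) id (fun _ => ε / 4) (ε / 4) (fun _ _ => le_rfl) 4 (by norm_num)
  refine ⟨u, ?_, fun x => ?_⟩
  · have h := Measure.countable_meas_pos_of_disjoint_iUnion (μ := μ)
      (As := fun a : u => ball (a : X) (ε / 4)) (fun _ => measurableSet_ball) (by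
        intro a b hab
        exact (hdisj a.2 b.2 (fun h => hab (Subtype.ext h))).mono ball_subset_closedBall
          ball_subset_closedBall)
    have h' : {a : u | 0 < μ (ball (a : X) (ε / 4))} = univ :=
      eq_univ_of_forall fun a => hμ.ball_pos _ _ (by positivity)
    rw [h', countable_univ_iff] at h
    exact h
  · obtain ⟨b, hb, h⟩ := hcov x (mem_univ x)
    refine ⟨b, hb, ?_⟩
    have := h (mem_closedBall_self (by positivity : (0 : ℝ) ≤ ε / 4))
    rw [mem_closedBall] at this
    simp only [id] at this
    linarith

/-- The covering principle behind every measure estimate of the proof: if `ν (B(x, 8t))` is at most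
`κ ν' (B(x, t))` for each ball of a family with bounded radii, then the same comparison holds for
the union of the family. It is the basic covering lemma of Vitali. -/
lemma measure_iUnion_ball_le (hμ : IsDoublingWith μ c) {ν ν' : Measure X} {κ : ℝ≥0∞}
    (P : Set (X × ℝ)) (R : ℝ) (hP : ∀ p ∈ P, 0 < p.2 ∧ p.2 ≤ R)
    (h : ∀ p ∈ P, ν (ball p.1 (8 * p.2)) ≤ κ * ν' (ball p.1 p.2)) :
    ν (⋃ p ∈ P, ball p.1 p.2) ≤ κ * ν' (⋃ p ∈ P, ball p.1 p.2) := by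
  have := hμ.secondCountableTopology
  obtain ⟨u, huP, hdisj, hcov⟩ := Vitali.exists_disjoint_subfamily_covering_enlargement_closedBall
    P Prod.fst Prod.snd R (fun p hp => (hP p hp).2) 4 (by norm_num)
  have hdisj' : u.PairwiseDisjoint fun p => ball p.1 p.2 := fun a ha b hb hab =>
    (hdisj ha hb hab).mono ball_subset_closedBall ball_subset_closedBall
  have hcount : u.Countable := hdisj'.countable_of_isOpen (fun _ _ => isOpen_ball)
    fun p hp => nonempty_ball.2 (hP p (huP hp)).1
  calc ν (⋃ p ∈ P, ball p.1 p.2) ≤ ν (⋃ p ∈ u, ball p.1 (8 * p.2)) := by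
        refine measure_mono (iUnion₂_subset fun p hp => ?_)
        obtain ⟨b, hb, hpb⟩ := hcov p hp
        have hb0 := (hP b (huP hb)).1
        exact (ball_subset_closedBall.trans hpb).trans ((closedBall_subset_ball (by linarith)).trans
          (subset_biUnion_of_mem (u := fun p : X × ℝ => ball p.1 (8 * p.2)) hb))
    _ ≤ ∑' p : u, ν (ball p.1.1 (8 * p.1.2)) := measure_biUnion_le ν hcount _
    _ ≤ ∑' p : u, κ * ν' (ball p.1.1 p.1.2) :=
        ENNReal.tsum_le_tsum fun p => h p (huP p.2)
    _ = κ * ν' (⋃ p ∈ u, ball p.1 p.2) := by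
        rw [ENNReal.tsum_mul_left, measure_biUnion hcount hdisj' fun _ _ => measurableSet_ball]
    _ ≤ _ := by
        gcongr κ * ν' ?_
        exact biUnion_subset_biUnion_left huP

/-- The covering principle for balls of one fixed radius centred at the points of a set `Y`. -/
lemma measure_le_of_forall_ball (hμ : IsDoublingWith μ c) {ν ν' : Measure X} {κ : ℝ≥0∞}
    {Y U : Set X} {t : ℝ} (ht : 0 < t)
    (h : ∀ x ∈ Y, ν (ball x (8 * t)) ≤ κ * ν' (ball x t)) (hU : ∀ x ∈ Y, ball x t ⊆ U) :
    ν Y ≤ κ * ν' U := by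
  have key := hμ.measure_iUnion_ball_le (ν := ν) (ν' := ν') (κ := κ) ((fun x => (x, t)) '' Y) t
    (by rintro _ ⟨x, -, rfl⟩; exact ⟨ht, le_rfl⟩) (by rintro _ ⟨x, hx, rfl⟩; exact h x hx)
  simp only [biUnion_image] at key
  calc ν Y ≤ ν (⋃ x ∈ Y, ball x t) :=
        measure_mono fun x hx => mem_biUnion hx (mem_ball_self ht)
    _ ≤ _ := key
    _ ≤ _ := by
      gcongr
      exact iUnion₂_subset hU

/-- The weak type estimate for the truncated maximal function, localized to a ball. -/
lemma measure_denseBalls_inter_le (hμ : IsDoublingWith μ c) (E : Set X) (s : ℝ) (z : X) {ρ r : ℝ}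
    (hρ : ρ ≤ r) :
    μ (denseBalls μ E (epow c s) ρ ∩ ball z r) ≤ epow c (3 - s) * μ (E ∩ ball z (3 * r)) := by
  have hc := hμ.one_lt
  set P := {p : X × ℝ | 0 < p.2 ∧ p.2 ≤ ρ ∧ epow c s * μ (ball p.1 p.2) ≤ μ (E ∩ ball p.1 p.2)}
  set P' := {p ∈ P | (ball p.1 p.2 ∩ ball z r).Nonempty}
  have hsub : ∀ p ∈ P', ball p.1 p.2 ⊆ ball z (3 * r) := by
    rintro p ⟨⟨h0, h1, -⟩, ⟨y, hy1, hy2⟩⟩ w hw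
    rw [mem_ball] at *
    have h4 : dist w z ≤ dist w p.1 + dist y p.1 + dist y z := by
      calc dist w z ≤ dist w p.1 + dist p.1 y + dist y z := dist_triangle4 _ _ _ _
        _ = _ := by rw [dist_comm p.1 y]
    linarith
  have key := hμ.measure_iUnion_ball_le (ν := μ) (ν' := μ.restrict E) (κ := epow c (3 - s)) P' ρ
    (fun p hp => ⟨hp.1.1, hp.1.2.1⟩) (by
      rintro p ⟨⟨h0, h1, h2⟩, -⟩
      rw [Measure.restrict_apply measurableSet_ball, inter_comm, sub_eq_add_neg, epow.add hc,
        mul_assoc]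
      refine (hμ.measure_ball_le h0 2 3 (by norm_num) (by rw [dist_self]; positivity)).trans ?_
      gcongr
      rw [epow.le_mul_iff hc, neg_neg]
      exact h2)
  calc μ (denseBalls μ E (epow c s) ρ ∩ ball z r) ≤ μ (⋃ p ∈ P', ball p.1 p.2) := by
        refine measure_mono ?_
        rintro x ⟨hx, hxz⟩
        obtain ⟨p, hp, hxp⟩ := mem_iUnion₂.1 hx
        exact mem_biUnion (show p ∈ P' from ⟨hp, ⟨x, hxp, hxz⟩⟩) hxp
    _ ≤ _ := key
    _ ≤ _ := by
      rw [Measure.restrict_apply (isOpen_biUnion fun _ _ => isOpen_ball).measurableSet, inter_comm]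
      gcongr
      exact iUnion₂_subset hsub

/-- A form of the Lebesgue density theorem: at almost every point of `E`, the set `E` has density at
least `c ^ (-2)` in all small open balls. -/
lemma ae_eventually_le_measure_inter_ball (hμ : IsDoublingWith μ c) (E : Set X) :
    ∀ᵐ x ∂μ, x ∈ E → ∀ᶠ r in 𝓝[>] (0 : ℝ), epow c (-2) * μ (ball x r) ≤ μ (E ∩ ball x r) := by
  have hc := hμ.one_lt
  have := hμ.isUnifLocDoublingMeasure
  have := hμ.secondCountableTopology
  have := hμ.isLocallyFiniteMeasure
  have := hμ.sigmaFinite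
  have hae : ∀ᵐ x ∂μ, x ∈ E → Tendsto (fun r : ℝ => μ (E ∩ closedBall x (r / 2)) /
      μ (closedBall x (r / 2))) (𝓝[>] 0) (𝓝 1) := by
    refine ae_imp_of_ae_restrict ?_
    filter_upwards [IsUnifLocDoublingMeasure.ae_tendsto_measure_inter_div μ E 1] with x hx
    refine hx (fun _ => x) (fun r => r / 2) ?_ ?_
    · refine tendsto_nhdsWithin_iff.2 ⟨?_, ?_⟩
      · have : Tendsto (fun r : ℝ => r / 2) (𝓝 0) (𝓝 (0 / 2)) := tendsto_id.div_const 2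
        rw [zero_div] at this
        exact this.mono_left nhdsWithin_le_nhds
      · filter_upwards [self_mem_nhdsWithin] with r hr
        rw [mem_Ioi] at *
        linarith
    · filter_upwards [self_mem_nhdsWithin] with r hr
      rw [mem_Ioi] at hr
      exact mem_closedBall_self (by linarith)
  filter_upwards [hae] with x hx hxE
  have h1 : epow c (-1) < 1 := by
    rw [← epow.zero c, epow.lt_iff hc]; norm_num
  filter_upwards [(hx hxE).eventually (lt_mem_nhds h1), self_mem_nhdsWithin] with r hr hr0
  rw [mem_Ioi] at hr0
  have h0 : μ (closedBall x (r / 2)) ≠ 0 := (lt_of_lt_of_le (hμ.ball_pos x (r / 2) (by linarith))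
    (measure_mono ball_subset_closedBall)).ne'
  have htop : μ (closedBall x (r / 2)) ≠ ∞ :=
    (lt_of_le_of_lt (measure_mono (closedBall_subset_ball (by linarith)))
      (hμ.ball_lt_top x r hr0)).ne
  rw [ENNReal.lt_div_iff_mul_lt (Or.inl h0) (Or.inl htop)] at hr
  have h2 : μ (ball x r) ≤ epow c 1 * μ (closedBall x (r / 2)) :=
    (hμ.measure_ball_le (y := x) (r := r / 2) (by linarith) 0 1 (by linarith)
      (by rw [dist_self]; positivity)).trans (by gcongr; exact ball_subset_closedBall)
  rw [epow.le_mul_iff hc] at h2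
  calc epow c (-2) * μ (ball x r) = epow c (-1) * (epow c (-1) * μ (ball x r)) := by
        rw [← mul_assoc, ← epow.add hc]; norm_num
    _ ≤ epow c (-1) * μ (closedBall x (r / 2)) := by gcongr
    _ ≤ μ (E ∩ closedBall x (r / 2)) := hr.le
    _ ≤ _ := by
      gcongr
      exact closedBall_subset_ball (by linarith)

end IsDoublingWith

end

/-! ### Functions of small norm have sparse zeros -/

section

namespace IsDoublingWith

variable {X : Type*} [MetricSpace X] [MeasurableSpace X] {μ : Measure X} {c : ℝ}

lemma measureReal_ball_pos (hμ : IsDoublingWith μ c) (x : X) {r : ℝ} (hr : 0 < r) :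
    0 < μ.real (ball x r) :=
  ENNReal.toReal_pos (hμ.measure_ball_ne_zero x hr) (hμ.measure_ball_ne_top x hr)

/-- A bound on the BMO norm controls the mean oscillation over each ball. -/
lemma setLIntegral_sub_average_le (hμ : IsDoublingWith μ c) {f : X → ℝ} {ε : ℝ}
    (hε : bmoNorm μ f ≤ ENNReal.ofReal ε) (x : X) {r : ℝ} (hr : 0 < r) :
    ∫⁻ y in ball x r, ‖f y - ⨍ z in ball x r, f z ∂μ‖ₑ ∂μ ≤ ENNReal.ofReal ε * μ (ball x r) := by
  have h : ⨍⁻ y in ball x r, ‖f y - ⨍ z in ball x r, f z ∂μ‖ₑ ∂μ ≤ ENNReal.ofReal ε :=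
    le_trans (le_iSup₂_of_le x r (le_iSup_of_le (f := fun _ : 0 < r =>
      ⨍⁻ y in ball x r, ‖f y - ⨍ z in ball x r, f z ∂μ‖ₑ ∂μ) hr le_rfl)) hε
  rw [setLAverage_eq] at h
  exact (ENNReal.div_le_iff (hμ.measure_ball_ne_zero x hr) (hμ.measure_ball_ne_top x hr)).1 h

lemma setIntegral_sub_average_le (hμ : IsDoublingWith μ c) {f : X → ℝ} {ε : ℝ} (hε0 : 0 ≤ ε)
    (hε : bmoNorm μ f ≤ ENNReal.ofReal ε) (x : X) {r : ℝ} (hr : 0 < r)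
    (hf : IntegrableOn f (ball x r) μ) :
    ∫ y in ball x r, |f y - ⨍ z in ball x r, f z ∂μ| ∂μ ≤ ε * μ.real (ball x r) := by
  have h := hμ.setLIntegral_sub_average_le hε x hr
  have hfin : μ (ball x r) ≠ ∞ := hμ.measure_ball_ne_top x hr
  have hint : IntegrableOn (fun y => f y - ⨍ z in ball x r, f z ∂μ) (ball x r) μ :=
    hf.sub (integrableOn_const hfin)
  have h2 := integral_norm_eq_lintegral_enorm hint.aestronglyMeasurable
  simp only [Real.norm_eq_abs] at h2
  rw [h2, Measure.real, ← ENNReal.toReal_ofReal hε0, ← ENNReal.toReal_mul]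
  exact ENNReal.toReal_mono (ENNReal.mul_ne_top ENNReal.ofReal_ne_top hfin) h

/-- Averages over nested balls of comparable measure differ by at most a multiple of the BMO
norm. -/
lemma abs_average_sub_average_le (hμ : IsDoublingWith μ c) [BorelSpace X] {f : X → ℝ} {ε C : ℝ}
    (hε0 : 0 ≤ ε)
    (hε : bmoNorm μ f ≤ ENNReal.ofReal ε) {x y : X} {r s : ℝ} (hs : 0 < s) (hr : 0 < r)
    (hf : IntegrableOn f (ball x r) μ)
    (hsub : ball y s ⊆ ball x r) (hC : μ.real (ball x r) ≤ C * μ.real (ball y s)) :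
    |(⨍ z in ball y s, f z ∂μ) - ⨍ z in ball x r, f z ∂μ| ≤ C * ε := by
  set m := ⨍ z in ball x r, f z ∂μ
  have hpos := hμ.measureReal_ball_pos y hs
  have hfy : IntegrableOn f (ball y s) μ := hf.mono_set hsub
  have hfin : μ (ball x r) ≠ ∞ := hμ.measure_ball_ne_top x hr
  have hfiny : μ (ball y s) ≠ ∞ := hμ.measure_ball_ne_top y hs
  have h1 : (⨍ z in ball y s, f z ∂μ) - m =
      (μ.real (ball y s))⁻¹ * ∫ z in ball y s, (f z - m) ∂μ := by
    rw [integral_sub hfy (integrableOn_const hfiny), setAverage_eq, setIntegral_const, smul_eq_mul,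
      smul_eq_mul]
    field_simp
  rw [h1, abs_mul, abs_of_pos (inv_pos.2 hpos), inv_mul_le_iff₀ hpos]
  have hint : IntegrableOn (fun z => |f z - m|) (ball x r) μ :=
    (hf.sub (integrableOn_const hfin)).abs
  calc |∫ z in ball y s, (f z - m) ∂μ| ≤ ∫ z in ball y s, |f z - m| ∂μ :=
        abs_integral_le_integral_abs
    _ ≤ ∫ z in ball x r, |f z - m| ∂μ :=
        setIntegral_mono_set hint (Eventually.of_forall fun _ => abs_nonneg _)
          hsub.eventuallyLE
    _ ≤ ε * μ.real (ball x r) := hμ.setIntegral_sub_average_le hε0 hε x hr hf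
    _ ≤ ε * (C * μ.real (ball y s)) := by gcongr
    _ = _ := by ring

lemma measureReal_ball_le (hμ : IsDoublingWith μ c) {x y : X} {r s : ℝ} (hr : 0 < r) (n : ℕ)
    (hs : s ≤ 2 ^ (n + 1) * r) (hy : dist x y < 2 ^ (n + 1) * r) :
    μ.real (ball x s) ≤ c ^ (n + 1) * μ.real (ball y r) := by
  have hc := hμ.one_lt
  have h := hμ.measure_ball_le hr n _ hs hy rfl
  have h2 := ENNReal.toReal_mono
    (ENNReal.mul_ne_top (epow.ne_top c _) (hμ.measure_ball_ne_top y hr)) h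
  rw [ENNReal.toReal_mul, epow, ENNReal.toReal_ofReal (Real.rpow_nonneg (by linarith) _)] at h2
  rw [← Nat.cast_succ, Real.rpow_natCast] at h2
  exact h2

lemma integrableOn_ball (hμ : IsDoublingWith μ c) {f : X → ℝ} (hf : AEStronglyMeasurable f μ)
    (h0 : ∀ x, 0 ≤ f x) (h1 : ∀ x, f x ≤ 1) (x : X) {r : ℝ} (hr : 0 < r) :
    IntegrableOn f (ball x r) μ := by
  refine IntegrableOn.of_bound (hμ.ball_lt_top x r hr) hf.restrict 1 ?_
  exact Eventually.of_forall fun y => by rw [Real.norm_eq_abs, abs_of_nonneg (h0 y)]; exact h1 y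

variable [BorelSpace X]

/-- At almost every zero of a nonnegative function, its averages over small balls tend to `0`. -/
lemma ae_exists_average_lt (hμ : IsDoublingWith μ c) {f : X → ℝ} (hf : LocallyIntegrable f μ)
    (h0 : ∀ x, 0 ≤ f x) (h1 : ∀ x, f x ≤ 1) {E : Set X} (hE : ∀ᵐ x ∂μ, x ∈ E → f x = 0)
    {s r : ℝ} (hs : 0 < s) (hr : 0 < r) :
    ∀ᵐ x ∂μ, x ∈ E → ∃ l : ℕ, ⨍ y in ball x (2⁻¹ ^ l * r), f y ∂μ < s := by
  have hc := hμ.one_lt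
  have := hμ.isUnifLocDoublingMeasure
  have := hμ.secondCountableTopology
  have := hμ.isLocallyFiniteMeasure
  have := hμ.sigmaFinite
  filter_upwards [hE, IsUnifLocDoublingMeasure.ae_tendsto_average μ hf 1] with x hx hav hxE
  have hlim : Tendsto (fun l : ℕ => (2⁻¹ : ℝ) ^ l * r) atTop (𝓝[>] 0) := by
    refine tendsto_nhdsWithin_iff.2 ⟨?_, Eventually.of_forall fun l => ?_⟩
    · simpa using (tendsto_pow_atTop_nhds_zero_of_lt_one (by norm_num : (0 : ℝ) ≤ 2⁻¹)
        (by norm_num)).mul_const r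
    · rw [mem_Ioi]; positivity
  have h := hav (fun _ => x) _ hlim (Eventually.of_forall fun l =>
    mem_closedBall_self (by positivity))
  rw [hx hxE] at h
  obtain ⟨l, hl⟩ := (h.eventually (gt_mem_nhds (by positivity : 0 < s / c))).exists
  refine ⟨l, ?_⟩
  set t := (2⁻¹ : ℝ) ^ l * r
  have ht0 : 0 < t := by positivity
  have hpos := hμ.measureReal_ball_pos x ht0
  have hf2 := hμ.integrableOn_ball hf.aestronglyMeasurable h0 h1 x (r := 2 * t) (by positivity)
  have hsub : closedBall x t ⊆ ball x (2 * t) := closedBall_subset_ball (by linarith)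
  have hfin : μ (ball x (2 * t)) ≠ ∞ := hμ.measure_ball_ne_top x (by positivity)
  have hd := hμ.measureReal_ball_le (x := x) (y := x) (s := 2 * t) ht0 0 (by simp)
    (by rw [dist_self]; positivity)
  rw [zero_add, pow_one] at hd
  have hcl : μ.real (closedBall x t) ≤ c * μ.real (ball x t) :=
    (measureReal_mono hsub hfin).trans hd
  have hcl0 : 0 < μ.real (closedBall x t) := hpos.trans_le
    (measureReal_mono ball_subset_closedBall (measure_ne_top_of_subset hsub hfin))
  rw [setAverage_eq, smul_eq_mul, inv_mul_lt_iff₀ hcl0] at hl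
  rw [setAverage_eq, smul_eq_mul, inv_mul_lt_iff₀ hpos]
  calc ∫ y in ball x t, f y ∂μ ≤ ∫ y in closedBall x t, f y ∂μ :=
        setIntegral_mono_set (hf2.mono_set hsub) (Eventually.of_forall fun _ => h0 _)
          ball_subset_closedBall.eventuallyLE
    _ < μ.real (closedBall x t) * (s / c) := hl
    _ ≤ c * μ.real (ball x t) * (s / c) := by gcongr
    _ = μ.real (ball x t) * s := by field_simp

/-- Exponential decay of the zero set. If `0 ≤ f ≤ 1` has BMO norm at most `ε` and its average over
a ball is at least `n D ε`, then the zeros of `f` fill at most the fraction `c ^ (-n)` of the ball.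
Stopping the first time the averages over shrinking balls have dropped by a definite multiple of `ε`
gives a family of balls which covers almost all zeros, whose union has small measure, and to which
the case `n - 1` applies. -/
lemma measure_zeros_inter_ball_le (hμ : IsDoublingWith μ c) {f : X → ℝ} {ε D : ℝ} (hε0 : 0 < ε)
    (hf : LocallyIntegrable f μ) (h0 : ∀ x, 0 ≤ f x) (h1 : ∀ x, f x ≤ 1)
    (hε : bmoNorm μ f ≤ ENNReal.ofReal ε) {E : Set X} (hE : ∀ᵐ x ∂μ, x ∈ E → f x = 0)
    (hD : D = 2 * (c ^ 8 + 2 * c + c ^ 2)) (n : ℕ) :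
    ∀ (z : X) (r : ℝ), 0 < r → n * (D * ε) ≤ ⨍ y in ball z r, f y ∂μ →
      μ (E ∩ ball z r) ≤ epow c (-n) * μ (ball z r) := by
  have hc := hμ.one_lt
  have hc8 : 0 < c ^ 8 := by positivity
  induction n with
  | zero =>
    intro z r hr _
    simp only [Nat.cast_zero, neg_zero, epow.zero, one_mul]
    exact measure_mono inter_subset_right
  | succ n ih =>
    intro z r hr hav
    have := hμ.secondCountableTopology
    have hD0 : 0 < D := by rw [hD]; positivity
    set s := (n + 1 : ℕ) * (D * ε) - D / 2 * ε with hs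
    have hs0 : 0 < s := by
      have : 0 ≤ (n : ℝ) * (D * ε) := by positivity
      have : 0 < D * ε := by positivity
      rw [hs]; push_cast; linarith
    have hint : ∀ (x : X) (r : ℝ), 0 < r → IntegrableOn f (ball x r) μ := fun x r hr =>
      hμ.integrableOn_ball hf.aestronglyMeasurable h0 h1 x hr
    set m := ⨍ y in ball z (2 * r), f y ∂μ
    have hr2 : 0 < 2 * r := by positivity
    have hzm : |(⨍ y in ball z r, f y ∂μ) - m| ≤ c * ε := by
      refine hμ.abs_average_sub_average_le hε0.le hε hr hr2 (hint _ _ hr2)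
        (ball_subset_ball (by linarith)) ?_
      simpa using hμ.measureReal_ball_le (x := z) (y := z) hr 0 (s := 2 * r) (by simp) (by simpa)
    have hm_ge : (n + 1 : ℕ) * (D * ε) - c * ε ≤ m := by
      have := (abs_le.1 hzm).2; linarith
    -- the averages over `B(x, r)`, for `x` in the given ball, have not dropped yet
    have hstart : ∀ x ∈ ball z r, s ≤ ⨍ y in ball x r, f y ∂μ := by
      intro x hx
      rw [mem_ball] at hx
      have hxm : |(⨍ y in ball x r, f y ∂μ) - m| ≤ c * ε := by
        refine hμ.abs_average_sub_average_le hε0.le hε hr hr2 (hint _ _ hr2)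
          (ball_subset_ball' (by linarith)) ?_
        simpa using hμ.measureReal_ball_le (x := z) (y := x) hr 0 (s := 2 * r) (by simp)
          (by rw [dist_comm, zero_add, pow_one]; linarith)
      have h2 := (abs_le.1 hxm).1
      have : D / 2 * ε = (c ^ 8 + c ^ 2) * ε + 2 * (c * ε) := by rw [hD]; ring
      have : 0 ≤ (c ^ 8 + c ^ 2) * ε := by positivity
      linarith
    set P : Set (X × ℝ) := {p | p.1 ∈ ball z r ∧ 0 < p.2 ∧ p.2 ≤ r / 2 ∧
      (⨍ y in ball p.1 p.2, f y ∂μ) < s ∧ s ≤ ⨍ y in ball p.1 (2 * p.2), f y ∂μ}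
    set U := ⋃ p ∈ P, ball p.1 p.2
    have hUo : IsOpen U := isOpen_biUnion fun _ _ => isOpen_ball
    have hcover : μ (E ∩ ball z r) ≤ μ.restrict E U := by
      rw [Measure.restrict_apply hUo.measurableSet]
      refine measure_mono_ae ?_
      filter_upwards [hμ.ae_exists_average_lt hf h0 h1 hE hs0 hr] with x hx hxm
      obtain ⟨hxE, hxz⟩ := hxm
      classical
      have hex := hx hxE
      set l := Nat.find hex with hl
      have hl1 := Nat.find_spec hex
      rw [← hl] at hl1
      have hl0 : l ≠ 0 := by
        intro h
        rw [h, pow_zero, one_mul] at hl1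
        exact absurd hl1 (not_lt.2 (hstart x hxz))
      obtain ⟨k, hk⟩ := Nat.exists_eq_succ_of_ne_zero hl0
      have hl2 := Nat.find_min hex (m := k) (by rw [← hl]; omega)
      rw [not_lt] at hl2
      have h2k : (2⁻¹ : ℝ) ^ k * r = 2 * (2⁻¹ ^ l * r) := by
        rw [hk, Nat.succ_eq_add_one, pow_succ]; ring
      refine ⟨mem_biUnion (show (x, (2⁻¹ : ℝ) ^ l * r) ∈ P from ⟨hxz, by positivity, ?_, hl1, ?_⟩)
        (mem_ball_self (by positivity)), hxE⟩
      · have : (2⁻¹ : ℝ) ^ k ≤ 1 := pow_le_one₀ (by norm_num) (by norm_num)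
        have : (2⁻¹ : ℝ) ^ k * r ≤ 1 * r := by gcongr
        simp only
        linarith
      · simp only
        rw [← h2k]; exact hl2
    have hcov1 : μ.restrict E U ≤ epow c (-n + 3) * μ U := by
      refine hμ.measure_iUnion_ball_le P (r / 2) (fun p hp => ⟨hp.2.1, hp.2.2.1⟩) ?_
      rintro ⟨x, t⟩ ⟨-, ht0, -, -, ht⟩
      simp only at ht0 ht ⊢
      rw [Measure.restrict_apply measurableSet_ball, inter_comm, epow.add hc, mul_assoc]
      have h8 : n * (D * ε) ≤ ⨍ y in ball x (8 * t), f y ∂μ := by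
        have h := hμ.abs_average_sub_average_le (C := c ^ 2) hε0.le hε (x := x) (y := x)
          (s := 2 * t) (r := 8 * t) (by positivity) (by positivity) (hint _ _ (by positivity))
          (ball_subset_ball (by linarith))
          (hμ.measureReal_ball_le (by positivity) 1 (by norm_num; linarith)
            (by rw [dist_self]; positivity))
        have h2 := (abs_le.1 h).2
        have e1 : D / 2 * ε = (c ^ 8 + 2 * c) * ε + c ^ 2 * ε := by rw [hD]; ring
        have e2 : 0 ≤ (c ^ 8 + 2 * c) * ε := by positivity
        have e3 : s = n * (D * ε) + 2 * (D / 2 * ε) - D / 2 * ε := by rw [hs]; push_cast; ring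
        linarith
      refine (ih x (8 * t) (by positivity) h8).trans ?_
      gcongr
      exact hμ.measure_ball_le ht0 2 3 (by norm_num) (by rw [dist_self]; positivity)
    set ν : Measure X := μ.withDensity fun y => ‖f y - m‖ₑ with hν
    -- the averages have dropped by `c ^ 8 * ε`, while doubling costs the factor `c ^ 7` in all:
    -- this leaves the gain `c ^ (-1)`
    have hκ : 0 < c ^ 8 * ε := by positivity
    have hcov2 : μ U ≤ (epow c 3 * (ENNReal.ofReal (c ^ 8 * ε))⁻¹) * ν U := by
      refine hμ.measure_iUnion_ball_le P (r / 2) (fun p hp => ⟨hp.2.1, hp.2.2.1⟩) ?_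
      rintro ⟨x, t⟩ ⟨hx, ht0, htr, ht, -⟩
      simp only at ht0 ht htr hx ⊢
      refine (hμ.measure_ball_le ht0 2 3 (by norm_num) (by rw [dist_self]; positivity)).trans ?_
      rw [mul_assoc]
      gcongr
      rw [← ENNReal.div_eq_inv_mul, ENNReal.le_div_iff_mul_le
        (Or.inl (ENNReal.ofReal_pos.2 hκ).ne') (Or.inl ENNReal.ofReal_ne_top), hν,
        withDensity_apply _ measurableSet_ball]
      have hfin := hμ.measure_ball_ne_top x ht0
      have hpos := hμ.measureReal_ball_pos x ht0
      have hi : IntegrableOn (fun y => f y - m) (ball x t) μ :=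
        (hint x t ht0).sub (integrableOn_const hfin)
      rw [← ofReal_integral_norm_eq_lintegral_enorm hi, ← ENNReal.ofReal_toReal hfin,
        ← ENNReal.ofReal_mul ENNReal.toReal_nonneg]
      refine ENNReal.ofReal_le_ofReal ?_
      change μ.real (ball x t) * _ ≤ _
      have h3 : ∫ y in ball x t, (m - f y) ∂μ ≤ ∫ y in ball x t, ‖f y - m‖ ∂μ := by
        refine setIntegral_mono_on ((integrableOn_const hfin).sub (hint x t ht0)) hi.norm
          measurableSet_ball fun y _ => ?_
        rw [Real.norm_eq_abs, abs_sub_comm]; exact le_abs_self _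
      refine le_trans ?_ h3
      rw [integral_sub (integrableOn_const (C := m) hfin) (hint x t ht0), setIntegral_const,
        smul_eq_mul]
      rw [setAverage_eq, smul_eq_mul, inv_mul_lt_iff₀ hpos] at ht
      have e1 : D / 2 * ε = c ^ 8 * ε + c * ε + (c + c ^ 2) * ε := by rw [hD]; ring
      have e2 : 0 ≤ (c + c ^ 2) * ε := by positivity
      have e3 : c ^ 8 * ε + s ≤ m := by rw [hs]; linarith
      nlinarith
    have hνU : ν U ≤ ENNReal.ofReal ε * μ (ball z (2 * r)) := by
      have hUsub : U ⊆ ball z (2 * r) := by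
        refine iUnion₂_subset fun p hp => ball_subset_ball' ?_
        have := mem_ball.1 hp.1
        linarith [hp.2.2.1]
      rw [hν, withDensity_apply _ hUo.measurableSet]
      exact (lintegral_mono_set hUsub).trans (hμ.setLIntegral_sub_average_le hε z hr2)
    have h2r : μ (ball z (2 * r)) ≤ epow c 1 * μ (ball z r) :=
      hμ.measure_ball_le hr 0 1 (by simp) (by simpa)
    calc μ (E ∩ ball z r) ≤ epow c (-n + 3) * ((epow c 3 * (ENNReal.ofReal (c ^ 8 * ε))⁻¹) *
          (ENNReal.ofReal ε * (epow c 1 * μ (ball z r)))) := by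
          refine hcover.trans (hcov1.trans ?_)
          gcongr
          refine hcov2.trans ?_
          gcongr
          exact hνU.trans (by gcongr)
      _ = epow c (-n + 3) * epow c 3 * epow c 1 * epow c (-8) * μ (ball z r) *
          ((ENNReal.ofReal ε)⁻¹ * ENNReal.ofReal ε) := by
          rw [ENNReal.ofReal_mul hc8.le, ENNReal.mul_inv (Or.inr ENNReal.ofReal_ne_top)
            (Or.inl ENNReal.ofReal_ne_top), epow.neg hc]
          have : ENNReal.ofReal (c ^ 8) = epow c 8 := by
            rw [epow]; congr 1; norm_cast
          rw [this]
          ring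
      _ = epow c (-(n + 1 : ℕ)) * μ (ball z r) := by
          rw [ENNReal.inv_mul_cancel (ENNReal.ofReal_pos.2 hε0).ne' ENNReal.ofReal_ne_top, mul_one,
            ← epow.add hc, ← epow.add hc, ← epow.add hc]
          congr 2
          push_cast; ring

/-- The density condition, for functions of small BMO norm that form a partition of unity: one of
the functions has average at least `1 / N` over a given ball. -/
lemma densityCondition_of_partition (hμ : IsDoublingWith μ c) {N : ℕ} (hN : 2 ≤ N) {D lam : ℝ}
    (hD : D = 2 * (c ^ 8 + 2 * c + c ^ 2)) (hlam : 1 < lam) {E : Fin N → Set X}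
    {f : Fin N → X → ℝ} (hf : IsPartitionVanishingOn μ E f) (hfl : ∀ j, LocallyIntegrable (f j) μ)
    (hnorm : ∀ j, bmoNorm μ (f j) ≤ ENNReal.ofReal ((5 * D * N)⁻¹ / lam)) :
    DensityCondition μ c lam E := by
  have hc := hμ.one_lt
  have := hμ.secondCountableTopology
  have hD0 : 0 < D := by rw [hD]; positivity
  have hN0 : (0 : ℝ) < N := by exact_mod_cast (by omega : 0 < N)
  intro z r hr
  have hpos := hμ.measureReal_ball_pos z hr
  have hfin := hμ.measure_ball_ne_top z hr
  have hint : ∀ j, IntegrableOn (f j) (ball z r) μ := fun j =>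
    hμ.integrableOn_ball (hfl j).aestronglyMeasurable (hf.nonneg j) (hf.le_one j) z hr
  have hsum : ∑ j, ⨍ y in ball z r, f j y ∂μ = 1 := by
    simp only [setAverage_eq, smul_eq_mul]
    rw [← Finset.mul_sum, ← integral_finsetSum _ fun j _ => hint j]
    simp only [hf.sum_eq_one]
    rw [setIntegral_const, smul_eq_mul, mul_one, inv_mul_cancel₀ hpos.ne']
  obtain ⟨j, hj⟩ : ∃ j, (N : ℝ)⁻¹ ≤ ⨍ y in ball z r, f j y ∂μ := by
    by_contra! hcon
    have h2 : ∑ j : Fin N, ⨍ y in ball z r, f j y ∂μ < ∑ _j : Fin N, (N : ℝ)⁻¹ :=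
      Finset.sum_lt_sum_of_nonempty ⟨⟨0, by omega⟩, Finset.mem_univ _⟩ fun j _ => hcon j
    rw [hsum, Finset.sum_const, Finset.card_univ, Fintype.card_fin, nsmul_eq_mul,
      mul_inv_cancel₀ hN0.ne'] at h2
    exact lt_irrefl _ h2
  set n := ⌈4 * lam⌉₊
  have hn1 : 4 * lam ≤ n := Nat.le_ceil _
  have hn2 : (n : ℝ) ≤ 5 * lam := by
    have := Nat.ceil_lt_add_one (by linarith : 0 ≤ 4 * lam)
    linarith
  have hε0 : 0 < (5 * D * N)⁻¹ / lam := by positivity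
  have hmain := hμ.measure_zeros_inter_ball_le hε0 (hfl j) (hf.nonneg j) (hf.le_one j) (hnorm j)
    (hf.ae_eq_zero j) hD n z r hr (by
      refine le_trans ?_ hj
      calc (n : ℝ) * (D * ((5 * D * N)⁻¹ / lam)) ≤ 5 * lam * (D * ((5 * D * N)⁻¹ / lam)) := by
            gcongr
        _ = (N : ℝ)⁻¹ := by field_simp)
  refine ciInf_le_of_le (finite_range _).bddBelow j ?_
  rw [div_le_iff₀ hpos]
  have h3 := ENNReal.toReal_mono (ENNReal.mul_ne_top (epow.ne_top c _) hfin)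
    (hmain.trans (mul_le_mul_left (epow.mono hc (by linarith : -(n : ℝ) ≤ -4 * lam)) _))
  rwa [ENNReal.toReal_mul, epow, ENNReal.toReal_ofReal (Real.rpow_nonneg (by linarith) _)] at h3

end IsDoublingWith

end

/-! ### One step of the construction -/

section

section Cutoff

variable {X : Type*} [MetricSpace X]

/-- The cutoff `max (1 - dist(x, S) / d) 0`; it vanishes identically when `S` is empty. -/
noncomputable def cutoff (d : ℝ) (S : Set X) (x : X) : ℝ := (thickenedIndicatorAux d S x).toReal

lemma cutoff_nonneg (d : ℝ) (S : Set X) (x : X) : 0 ≤ cutoff d S x := ENNReal.toReal_nonneg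

lemma cutoff_le_one (d : ℝ) (S : Set X) (x : X) : cutoff d S x ≤ 1 := by
  have h := ENNReal.toReal_mono ENNReal.one_ne_top (thickenedIndicatorAux_le_one d S x)
  simpa [cutoff] using h

lemma cutoff_eq_one (d : ℝ) {S : Set X} {x : X} (hx : x ∈ S) : cutoff d S x = 1 := by
  rw [cutoff, thickenedIndicatorAux_one d S hx, ENNReal.toReal_one]

lemma cutoff_eq_zero {d : ℝ} (hd : 0 < d) {S : Set X} {x : X} (hx : x ∉ thickening d S) :
    cutoff d S x = 0 := by
  rw [cutoff, thickenedIndicatorAux_zero hd S hx, ENNReal.toReal_zero]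

lemma abs_cutoff_sub_le {d : ℝ} (hd : 0 < d) (S : Set X) (x y : X) :
    |cutoff d S x - cutoff d S y| ≤ dist x y / d := by
  have h := (lipschitzWith_thickenedIndicator hd S).dist_le_mul x y
  have hd' : ((d.toNNReal⁻¹ : NNReal) : ℝ) = d⁻¹ := by
    rw [NNReal.coe_inv, Real.coe_toNNReal _ hd.le]
  rw [hd', ← div_eq_inv_mul] at h
  exact h

end Cutoff

variable {X : Type*} [MetricSpace X] [MeasurableSpace X] {N : ℕ}

/-- The Lipschitz constant, in units of the scale, of the functions of the construction. -/
def stepLip (N : ℕ) : ℝ := 2 * (N + 1) ^ 2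

/-- The points at which the value `V j` is too large to be compatible with the density of `E j`
at scale `d`. -/
def pushSet (μ : Measure X) (c : ℝ) (E : Fin N → Set X) (V : Fin N → X → ℝ) (d : ℝ) (j : Fin N) :
    Set X :=
  {y | epow c (4 * (stepLip N + 1 - V j y)) * μ (ball y (8 * d)) < μ (E j ∩ ball y (8 * d))}

/-- The points at which `E j` has very small density, at scale `d`. -/
def sparseSet (μ : Measure X) (c M : ℝ) (E : Fin N → Set X) (d : ℝ) (j : Fin N) : Set X :=
  {x | μ (E j ∩ ball x (16 * d)) ≤ epow c (-(8 * M)) * μ (ball x (16 * d))}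

/-- The amount by which `V j` is pushed down at scale `d`. -/
noncomputable def pushAmount (μ : Measure X) (c : ℝ) (E : Fin N → Set X) (V : Fin N → X → ℝ)
    (d : ℝ) (j : Fin N) (x : X) : ℝ :=
  cutoff d (thickening d (pushSet μ c E V d j)) x

/-- A Lipschitz partition of unity subordinate to the neighbourhoods of the sets `sparseSet`. -/
noncomputable def sparseWeight (μ : Measure X) (c M : ℝ) (E : Fin N → Set X) (d : ℝ) (j : Fin N)
    (x : X) : ℝ :=
  cutoff d (sparseSet μ c M E d j) x / ∑ i, cutoff d (sparseSet μ c M E d i) x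

/-- One step of the construction, at scale `d`: the functions that are too large are pushed down by
at most `1`, and the total amount removed is given to functions whose sets are very sparse. -/
noncomputable def pushStep (μ : Measure X) (c M : ℝ) (E : Fin N → Set X) (d : ℝ)
    (V : Fin N → X → ℝ) (j : Fin N) (x : X) : ℝ :=
  V j x - pushAmount μ c E V d j x +
    (∑ i, pushAmount μ c E V d i x) * sparseWeight μ c M E d j x

/-- The zone in which a step at scale `d` may change the functions. -/
def activeZone (μ : Measure X) (c : ℝ) (E : Fin N → Set X) (V : Fin N → X → ℝ) (d : ℝ) :
    Set X :=
  ⋃ i, thickening (2 * d) (pushSet μ c E V d i)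

/-- The zone in which a step at scale `d` may increase the function with index `j`. -/
def raiseZone (μ : Measure X) (c M : ℝ) (E : Fin N → Set X) (V : Fin N → X → ℝ) (d : ℝ)
    (j : Fin N) : Set X :=
  activeZone μ c E V d ∩ thickening d (sparseSet μ c M E d j)

/-- The family `V` is admissible at scale `δ`: it consists of nonnegative functions with sum `M`,
Lipschitz at scale `δ`, and `V j` is bounded by minus the logarithm of the density of `E j` at that
scale, up to normalization. -/
structure IsAdmissible (μ : Measure X) (c M : ℝ) (E : Fin N → Set X) (V : Fin N → X → ℝ)
    (δ : ℝ) : Prop where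
  nonneg : ∀ j x, 0 ≤ V j x
  sum_eq : ∀ x, ∑ j, V j x = M
  lip : ∀ j x y, |V j x - V j y| ≤ stepLip N / δ * dist x y
  density : ∀ j y, μ (E j ∩ ball y (8 * δ)) ≤
    epow c (4 * (stepLip N + 1 - V j y)) * μ (ball y (8 * δ))

section Step

variable {μ : Measure X} {c M d δ : ℝ} {E : Fin N → Set X} {V : Fin N → X → ℝ}

lemma stepLip_pos (N : ℕ) : 0 < stepLip N := by unfold stepLip; positivity

lemma isOpen_activeZone : IsOpen (activeZone μ c E V d) := isOpen_iUnion fun _ => isOpen_thickening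

lemma isOpen_raiseZone (j : Fin N) : IsOpen (raiseZone μ c M E V d j) :=
  isOpen_activeZone.inter isOpen_thickening

lemma pushAmount_nonneg (j : Fin N) (x : X) : 0 ≤ pushAmount μ c E V d j x := cutoff_nonneg _ _ _

lemma pushAmount_le_one (j : Fin N) (x : X) : pushAmount μ c E V d j x ≤ 1 := cutoff_le_one _ _ _

lemma exists_mem_pushSet_of_pushAmount_ne_zero (hd : 0 < d) {j : Fin N} {x : X}
    (h : pushAmount μ c E V d j x ≠ 0) : ∃ y ∈ pushSet μ c E V d j, dist x y < 2 * d := by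
  have hx : x ∈ thickening d (thickening d (pushSet μ c E V d j)) := by
    by_contra hx
    exact h (cutoff_eq_zero hd hx)
  have := thickening_thickening_subset d d (pushSet μ c E V d j) hx
  rw [← two_mul] at this
  exact mem_thickening_iff.1 this

lemma pushAmount_eq_zero (hd : 0 < d) {x : X} (hx : x ∉ activeZone μ c E V d) (j : Fin N) :
    pushAmount μ c E V d j x = 0 := by
  by_contra h
  exact hx (mem_iUnion.2 ⟨j, mem_thickening_iff.2 (exists_mem_pushSet_of_pushAmount_ne_zero hd h)⟩)

lemma sparseWeight_nonneg (j : Fin N) (x : X) : 0 ≤ sparseWeight μ c M E d j x :=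
  div_nonneg (cutoff_nonneg _ _ _) (Finset.sum_nonneg fun _ _ => cutoff_nonneg _ _ _)

lemma sparseWeight_le_one (j : Fin N) (x : X) : sparseWeight μ c M E d j x ≤ 1 :=
  div_le_one_of_le₀ (Finset.single_le_sum (f := fun i => cutoff d (sparseSet μ c M E d i) x)
    (fun _ _ => cutoff_nonneg _ _ _) (Finset.mem_univ j))
    (Finset.sum_nonneg fun _ _ => cutoff_nonneg _ _ _)

lemma pushStep_eq_of_notMem (hd : 0 < d) {x : X} (hx : x ∉ activeZone μ c E V d) (j : Fin N) :
    pushStep μ c M E d V j x = V j x := by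
  simp [pushStep, pushAmount_eq_zero hd hx]

lemma abs_pushStep_sub_le (j : Fin N) (x : X) : |pushStep μ c M E d V j x - V j x| ≤ N := by
  have h0 : pushAmount μ c E V d j x ≤ ∑ i, pushAmount μ c E V d i x :=
    Finset.single_le_sum (f := fun i => pushAmount μ c E V d i x)
      (fun _ _ => pushAmount_nonneg _ _) (Finset.mem_univ j)
  have h1 : ∑ i, pushAmount μ c E V d i x ≤ N := by
    calc ∑ i, pushAmount μ c E V d i x ≤ ∑ _i : Fin N, (1 : ℝ) :=
          Finset.sum_le_sum fun i _ => pushAmount_le_one i x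
      _ = N := by simp
  have h2 := pushAmount_nonneg (μ := μ) (c := c) (E := E) (V := V) (d := d) j x
  have h3 := sparseWeight_nonneg (μ := μ) (c := c) (M := M) (E := E) (d := d) j x
  have h4 := sparseWeight_le_one (μ := μ) (c := c) (M := M) (E := E) (d := d) j x
  rw [pushStep, abs_le]
  constructor <;> nlinarith

/-- Where `V j` is not raised, the step only pushes it down, and by `1` near the push set. -/
lemma pushStep_le (hd : 0 < d) {j : Fin N} {x : X} (hx : x ∉ raiseZone μ c M E V d j) :
    pushStep μ c M E d V j x ≤
      V j x - (thickening d (pushSet μ c E V d j)).indicator (fun _ => 1) x := by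
  have h1 : (∑ i, pushAmount μ c E V d i x) * sparseWeight μ c M E d j x = 0 := by
    by_cases hW : x ∈ activeZone μ c E V d
    · have : x ∉ thickening d (sparseSet μ c M E d j) := fun h => hx ⟨hW, h⟩
      rw [sparseWeight, cutoff_eq_zero hd this, zero_div, mul_zero]
    · simp [pushAmount_eq_zero hd hW]
  rw [pushStep, h1, add_zero]
  gcongr
  by_cases hT : x ∈ thickening d (pushSet μ c E V d j)
  · rw [indicator_of_mem hT, pushAmount, cutoff_eq_one d hT]
  · rw [indicator_of_notMem hT]; exact pushAmount_nonneg j x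

/-- Near a point of the push set, `E j` is dense at scale `d` compared with the value of `V j`. -/
lemma IsAdmissible.mem_denseBalls (hV : IsAdmissible μ c M E V δ) (hc : 1 < c) (hd : 0 < d)
    (hdδ : d ≤ δ) {j : Fin N} {x : X} (hx : x ∈ thickening d (pushSet μ c E V d j)) :
    x ∈ denseBalls μ (E j) (epow c (4 * (1 - V j x))) (8 * d) := by
  obtain ⟨y, hy, hxy⟩ := mem_thickening_iff.1 hx
  refine mem_biUnion (show (y, 8 * d) ∈ _ from ⟨by positivity, le_rfl, le_trans ?_ hy.le⟩) ?_
  · simp only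
    gcongr
    refine epow.mono hc ?_
    have h1 := (abs_le.1 (hV.lip j x y)).1
    have hL := stepLip_pos N
    have h2 : stepLip N / δ * dist x y ≤ stepLip N := by
      rw [div_mul_eq_mul_div, div_le_iff₀ (by linarith)]
      gcongr
      linarith
    linarith
  · rw [mem_ball]; linarith

lemma measure_inter_ball_le_of_mem_thickening (hμ : IsDoublingWith μ c) (hd : 0 < d) {j : Fin N}
    {x : X} (hx : x ∈ thickening d (sparseSet μ c M E d j)) :
    μ (E j ∩ ball x (8 * d)) ≤ epow c (1 - 8 * M) * μ (ball x (8 * d)) := by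
  obtain ⟨y, hy, hxy⟩ := mem_thickening_iff.1 hx
  calc μ (E j ∩ ball x (8 * d)) ≤ μ (E j ∩ ball y (16 * d)) := by
        gcongr
        exact ball_subset_ball' (by linarith)
    _ ≤ epow c (-(8 * M)) * μ (ball y (16 * d)) := hy
    _ ≤ epow c (-(8 * M)) * (epow c 1 * μ (ball x (8 * d))) := by
        gcongr
        exact hμ.measure_ball_le (by positivity) 0 1 (by rw [zero_add, pow_one]; linarith)
          (by rw [dist_comm, zero_add, pow_one]; linarith)
    _ = _ := by
        rw [← mul_assoc, ← epow.add hμ.one_lt]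
        congr 2; ring

lemma one_le_sum_cutoff (hd : 0 < d)
    (hmin : ∀ (x : X) (r : ℝ), 0 < r →
      ∃ j, μ (E j ∩ ball x r) ≤ epow c (-(8 * M)) * μ (ball x r)) (x : X) :
    1 ≤ ∑ i, cutoff d (sparseSet μ c M E d i) x := by
  obtain ⟨j, hj⟩ := hmin x (16 * d) (by positivity)
  have h : cutoff d (sparseSet μ c M E d j) x = 1 := cutoff_eq_one d hj
  rw [← h]
  exact Finset.single_le_sum (f := fun i => cutoff d (sparseSet μ c M E d i) x)
    (fun _ _ => cutoff_nonneg _ _ _) (Finset.mem_univ j)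

lemma abs_sparseWeight_sub_le (hd : 0 < d)
    (hmin : ∀ (x : X) (r : ℝ), 0 < r →
      ∃ j, μ (E j ∩ ball x r) ≤ epow c (-(8 * M)) * μ (ball x r)) (j : Fin N) (x y : X) :
    |sparseWeight μ c M E d j x - sparseWeight μ c M E d j y| ≤ (N + 1) * (dist x y / d) := by
  set g := fun i x => cutoff d (sparseSet μ c M E d i) x
  set G := fun x => ∑ i, g i x with hG
  have hGx : 1 ≤ G x := one_le_sum_cutoff hd hmin x
  have hGy : 1 ≤ G y := one_le_sum_cutoff hd hmin y
  have hgy : 0 ≤ g j y / G y ∧ g j y / G y ≤ 1 :=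
    ⟨sparseWeight_nonneg (μ := μ) (c := c) (M := M) (E := E) j y, sparseWeight_le_one j y⟩
  have hgg : |g j x - g j y| ≤ dist x y / d := abs_cutoff_sub_le hd _ x y
  have hGG : |G y - G x| ≤ N * (dist x y / d) := by
    rw [hG]
    simp only
    rw [← Finset.sum_sub_distrib]
    refine (Finset.abs_sum_le_sum_abs _ _).trans ?_
    calc ∑ i, |g i y - g i x| ≤ ∑ _i : Fin N, dist x y / d :=
          Finset.sum_le_sum fun i _ => by rw [abs_sub_comm]; exact abs_cutoff_sub_le hd _ x y
      _ = _ := by simp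
  change |g j x / G x - g j y / G y| ≤ _
  have e : g j x / G x - g j y / G y = ((g j x - g j y) + g j y / G y * (G y - G x)) / G x := by
    field_simp
    ring
  rw [e, abs_div, abs_of_pos (by linarith : 0 < G x)]
  refine (div_le_self (abs_nonneg _) hGx).trans ((abs_add_le _ _).trans ?_)
  rw [abs_mul, abs_of_nonneg hgy.1]
  have : g j y / G y * |G y - G x| ≤ 1 * |G y - G x| := by
    gcongr; exact hgy.2
  linarith

/-- The step of the construction preserves admissibility, at a scale `16` times smaller. -/
lemma IsAdmissible.pushStep (hV : IsAdmissible μ c M E V δ) (hμ : IsDoublingWith μ c) (hM : 0 < M)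
    (hδ : 0 < δ) (hdδ : δ = 16 * d)
    (hmin : ∀ (x : X) (r : ℝ), 0 < r →
      ∃ j, μ (E j ∩ ball x r) ≤ epow c (-(8 * M)) * μ (ball x r)) :
    IsAdmissible μ c M E (pushStep μ c M E d V) d := by
  have hc := hμ.one_lt
  have hd : 0 < d := by linarith
  have hL := stepLip_pos N
  have hbs : ∀ j x y, |pushAmount μ c E V d j x - pushAmount μ c E V d j y| ≤ dist x y / d :=
    fun j x y => abs_cutoff_sub_le hd _ x y
  have hw1 : ∀ x, ∑ j, sparseWeight μ c M E d j x = 1 := fun x => by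
    have := one_le_sum_cutoff hd hmin x
    simp only [sparseWeight]
    rw [← Finset.sum_div, div_self (by linarith)]
  have hb0 : ∀ x, 0 ≤ ∑ i, pushAmount μ c E V d i x := fun x =>
    Finset.sum_nonneg fun i _ => pushAmount_nonneg i x
  have hbN : ∀ x, ∑ i, pushAmount μ c E V d i x ≤ N := fun x => by
    calc ∑ i, pushAmount μ c E V d i x ≤ ∑ _i : Fin N, (1 : ℝ) :=
          Finset.sum_le_sum fun i _ => pushAmount_le_one i x
      _ = N := by simp
  have hbss : ∀ x y, |∑ i, pushAmount μ c E V d i x - ∑ i, pushAmount μ c E V d i y| ≤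
      N * (dist x y / d) := fun x y => by
    rw [← Finset.sum_sub_distrib]
    refine (Finset.abs_sum_le_sum_abs _ _).trans ?_
    calc ∑ i, |pushAmount μ c E V d i x - pushAmount μ c E V d i y|
        ≤ ∑ _i : Fin N, dist x y / d := Finset.sum_le_sum fun i _ => hbs i x y
      _ = _ := by simp
  -- where `V j` is pushed it is larger than `1`, because a density is at most `1`
  have hpush : ∀ j x, pushAmount μ c E V d j x ≤ V j x := fun j x => by
    by_cases hb : pushAmount μ c E V d j x = 0
    · rw [hb]; exact hV.nonneg j x
    · obtain ⟨y, hy, hxy⟩ := exists_mem_pushSet_of_pushAmount_ne_zero hd hb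
      have hyV : stepLip N + 1 < V j y := by
        by_contra hcon
        have h1 : 1 ≤ epow c (4 * (stepLip N + 1 - V j y)) :=
          epow.one_le hc (by linarith)
        have h2 : μ (ball y (8 * d)) < μ (E j ∩ ball y (8 * d)) :=
          lt_of_le_of_lt (le_mul_of_one_le_left zero_le h1) hy
        exact absurd h2 (not_lt.2 (measure_mono inter_subset_right))
      have h3 := (abs_le.1 (hV.lip j x y)).1
      have h4 : stepLip N / δ * dist x y ≤ stepLip N := by
        rw [div_mul_eq_mul_div, div_le_iff₀ hδ]
        gcongr
        linarith
      exact (pushAmount_le_one j x).trans (by linarith)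
  have hnonneg : ∀ j x, 0 ≤ _root_.pushStep μ c M E d V j x := fun j x => by
    have := hpush j x
    have := mul_nonneg (hb0 x)
      (sparseWeight_nonneg (μ := μ) (c := c) (M := M) (E := E) (d := d) j x)
    rw [_root_.pushStep]; linarith
  have hsum : ∀ x, ∑ j, _root_.pushStep μ c M E d V j x = M := fun x => by
    simp only [_root_.pushStep]
    rw [Finset.sum_add_distrib, Finset.sum_sub_distrib, ← Finset.mul_sum, hw1, hV.sum_eq]
    ring
  refine ⟨hnonneg, hsum, fun j x y => ?_, fun j y => ?_⟩
  · have h1 := hV.lip j x y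
    have h2 := hbs j x y
    have h3 := hbss x y
    have h4 := abs_sparseWeight_sub_le hd hmin j x y
    set t := dist x y / d with ht
    have ht0 : 0 ≤ t := by positivity
    have e1 : stepLip N / δ * dist x y = stepLip N / 16 * t := by
      rw [hdδ, ht]; field_simp
    have e2 : stepLip N / d * dist x y = stepLip N * t := by rw [ht]; field_simp
    rw [e1] at h1
    rw [e2]
    have e3 : _root_.pushStep μ c M E d V j x - _root_.pushStep μ c M E d V j y =
        (V j x - V j y) - (pushAmount μ c E V d j x - pushAmount μ c E V d j y) +
        ((∑ i, pushAmount μ c E V d i x) *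
          (sparseWeight μ c M E d j x - sparseWeight μ c M E d j y) +
        (∑ i, pushAmount μ c E V d i x - ∑ i, pushAmount μ c E V d i y) *
          sparseWeight μ c M E d j y) := by
      simp only [_root_.pushStep]; ring
    have h5 : |(∑ i, pushAmount μ c E V d i x) *
        (sparseWeight μ c M E d j x - sparseWeight μ c M E d j y)| ≤ N * ((N + 1) * t) := by
      rw [abs_mul, abs_of_nonneg (hb0 x)]
      gcongr
      exact hbN x
    have h6 : |(∑ i, pushAmount μ c E V d i x - ∑ i, pushAmount μ c E V d i y) *
        sparseWeight μ c M E d j y| ≤ N * t * 1 := by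
      rw [abs_mul, abs_of_nonneg (sparseWeight_nonneg j y)]
      gcongr
      · exact sparseWeight_nonneg j y
      · exact sparseWeight_le_one j y
    rw [e3]
    calc _ ≤ |V j x - V j y| + |pushAmount μ c E V d j x - pushAmount μ c E V d j y| +
          (|(∑ i, pushAmount μ c E V d i x) *
          (sparseWeight μ c M E d j x - sparseWeight μ c M E d j y)| +
        |(∑ i, pushAmount μ c E V d i x - ∑ i, pushAmount μ c E V d i y) *
          sparseWeight μ c M E d j y|) :=
          (abs_add_le _ _).trans (add_le_add (abs_sub _ _) (abs_add_le _ _))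
      _ ≤ stepLip N / 16 * t + t + (N * ((N + 1) * t) + N * t * 1) := by gcongr
      _ = (stepLip N / 16 + (N + 1) ^ 2) * t := by ring
      _ ≤ stepLip N * t := by
          gcongr
          have : ((N : ℝ) + 1) ^ 2 = stepLip N / 2 := by rw [stepLip]; ring
          linarith
  · by_cases hR : y ∈ raiseZone μ c M E V d j
    · refine (measure_inter_ball_le_of_mem_thickening hμ hd hR.2).trans ?_
      gcongr
      refine epow.mono hc ?_
      have : _root_.pushStep μ c M E d V j y ≤ M := by
        refine le_of_le_of_eq ?_ (hsum y)
        exact Finset.single_le_sum (f := fun j => _root_.pushStep μ c M E d V j y)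
          (fun i _ => hnonneg i y) (Finset.mem_univ j)
      linarith
    · have hle := pushStep_le hd hR
      by_cases hS : y ∈ pushSet μ c E V d j
      · have hT : y ∈ thickening d (pushSet μ c E V d j) := self_subset_thickening hd _ hS
        rw [indicator_of_mem hT] at hle
        calc μ (E j ∩ ball y (8 * d)) ≤ μ (E j ∩ ball y (8 * δ)) := by
              gcongr
              linarith
          _ ≤ epow c (4 * (stepLip N + 1 - V j y)) * μ (ball y (8 * δ)) := hV.density j y
          _ ≤ epow c (4 * (stepLip N + 1 - V j y)) * (epow c 4 * μ (ball y (8 * d))) := by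
              gcongr
              exact hμ.measure_ball_le (by positivity) 3 4 (by rw [hdδ]; norm_num; linarith)
                (by rw [dist_self]; positivity)
          _ ≤ _ := by
              rw [← mul_assoc, ← epow.add hc]
              gcongr
              exact epow.mono hc (by linarith)
      · have hT : 0 ≤ (thickening d (pushSet μ c E V d j)).indicator (fun _ => (1 : ℝ)) y :=
          indicator_nonneg (fun _ _ => zero_le_one) _
        rw [pushSet, mem_ofPred_eq, not_lt] at hS
        refine hS.trans ?_
        gcongr
        exact epow.mono hc (by linarith)

end Step

end

/-! ### The packing estimate -/

section

variable {X : Type*} [MetricSpace X] [MeasurableSpace X] {N : ℕ}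

section Excess

variable {μ : Measure X} {c : ℝ}

/-- The excess of the density of `E`, over all balls of radius at most `ρ` containing `x`, above the
level `c ^ (4 * (1 - H))`, measured in powers of `c ^ 4`. A function starting from the value `H` can
be pushed down at most that many times at `x`, if it is not raised in between. -/
noncomputable def excess (μ : Measure X) (c : ℝ) (E : Set X) (ρ H : ℝ) (x : X) : ℝ≥0∞ :=
  ∑' t : ℕ, (denseBalls μ E (epow c (4 * (1 - H + t))) ρ).indicator (fun _ => 1) x

lemma denseBalls_subset {E : Set X} {s s' : ℝ≥0∞} {ρ ρ' : ℝ} (hs : s' ≤ s) (hρ : ρ ≤ ρ') :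
    denseBalls μ E s ρ ⊆ denseBalls μ E s' ρ' :=
  biUnion_subset_biUnion_left fun _ hp =>
    ⟨hp.1, hp.2.1.trans hρ, le_trans (by gcongr) hp.2.2⟩

lemma excess_mono (hc : 1 < c) (E : Set X) {ρ ρ' H H' : ℝ} (hρ : ρ ≤ ρ') (hH : H ≤ H') (x : X) :
    excess μ c E ρ H x ≤ excess μ c E ρ' H' x :=
  ENNReal.tsum_le_tsum fun t => indicator_le_indicator_of_subset
    (denseBalls_subset (epow.mono hc (by linarith)) hρ) (fun _ => zero_le) x

lemma excess_eq_add (E : Set X) {ρ H : ℝ} {x : X}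
    (hx : x ∈ denseBalls μ E (epow c (4 * (1 - H))) ρ) :
    excess μ c E ρ H x = 1 + excess μ c E ρ (H - 1) x := by
  rw [excess, tsum_eq_zero_add' ENNReal.summable]
  congr 1
  · rw [indicator_of_mem]
    simpa using hx
  · refine tsum_congr fun t => ?_
    congr 4
    push_cast; ring

variable [BorelSpace X]

lemma measurable_excess (E : Set X) (ρ H : ℝ) : Measurable (excess μ c E ρ H) :=
  Measurable.tsum fun _ =>
    measurable_const.indicator (isOpen_denseBalls _ _ _).measurableSet

lemma IsDoublingWith.setLIntegral_excess_le (hμ : IsDoublingWith μ c) (E : Set X) (z : X)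
    {ρ r : ℝ} (H : ℝ) (hρ : ρ ≤ r) :
    ∫⁻ x in ball z r, excess μ c E ρ H x ∂μ ≤
      epow c (4 * (H - 1) + 3) * (1 - epow c (-4))⁻¹ * μ (E ∩ ball z (3 * r)) := by
  have hc := hμ.one_lt
  have hm : ∀ t : ℕ, MeasurableSet (denseBalls μ E (epow c (4 * (1 - H + t))) ρ) := fun t =>
    (isOpen_denseBalls _ _ _).measurableSet
  simp only [excess]
  rw [lintegral_tsum fun t => (measurable_const.indicator (hm t)).aemeasurable]
  calc ∑' t : ℕ, ∫⁻ x in ball z r,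
        (denseBalls μ E (epow c (4 * (1 - H + t))) ρ).indicator (fun _ => 1) x ∂μ
      ≤ ∑' t : ℕ, epow c (4 * (H - 1) + 3) * epow c (-4) ^ t * μ (E ∩ ball z (3 * r)) := by
        refine ENNReal.tsum_le_tsum fun t => ?_
        rw [lintegral_indicator (hm t), setLIntegral_one, Measure.restrict_apply (hm t)]
        refine (hμ.measure_denseBalls_inter_le E _ z hρ).trans_eq ?_
        rw [epow.pow_natCast hc, ← epow.add hc]
        congr 2
        ring
    _ = _ := by
        rw [ENNReal.tsum_mul_right, ENNReal.tsum_mul_left, ENNReal.tsum_geometric]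

end Excess

/-- A sequence of families obtained from each other by the steps of the construction, at the scales
`δ i`. -/
structure IsPushSequence (μ : Measure X) (c M : ℝ) (E : Fin N → Set X) (V : ℕ → Fin N → X → ℝ)
    (δ : ℕ → ℝ) : Prop where
  scale_pos : ∀ i, 0 < δ i
  scale_succ : ∀ i, δ i = 16 * δ (i + 1)
  admissible : ∀ i, IsAdmissible μ c M E (V i) (δ i)
  step : ∀ i, V (i + 1) = pushStep μ c M E (δ (i + 1)) (V i)

/-- A neighbourhood of the zone in which the families `V i` and `V (i + 1)` differ. -/
def changeZone (μ : Measure X) (c : ℝ) (E : Fin N → Set X) (V : ℕ → Fin N → X → ℝ) (δ : ℕ → ℝ)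
    (i : ℕ) : Set X :=
  ⋃ j, thickening (4 * δ (i + 1)) (pushSet μ c E (V i) (δ (i + 1)) j)

lemma isOpen_changeZone (μ : Measure X) (c : ℝ) (E : Fin N → Set X) (V : ℕ → Fin N → X → ℝ)
    (δ : ℕ → ℝ) (i : ℕ) : IsOpen (changeZone μ c E V δ i) :=
  isOpen_iUnion fun _ => isOpen_thickening

namespace IsPushSequence

variable {μ : Measure X} {c M : ℝ} {E : Fin N → Set X} {V : ℕ → Fin N → X → ℝ} {δ : ℕ → ℝ}

lemma scale_le (hV : IsPushSequence μ c M E V δ) {i k : ℕ} (h : k ≤ i) : δ i ≤ δ k := by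
  refine antitone_nat_of_succ_le (f := δ) (fun n => ?_) h
  have := hV.scale_succ n
  have := hV.scale_pos (n + 1)
  linarith

lemma le_sum (hV : IsPushSequence μ c M E V δ) (i : ℕ) (j : Fin N) (x : X) : V i j x ≤ M := by
  rw [← (hV.admissible i).sum_eq x]
  exact Finset.single_le_sum (f := fun j => V i j x) (fun j _ => (hV.admissible i).nonneg j x)
    (Finset.mem_univ j)

lemma abs_sub_le_indicator (hV : IsPushSequence μ c M E V δ) (i : ℕ) (j : Fin N) (x : X) :
    |V (i + 1) j x - V i j x| ≤ N * (changeZone μ c E V δ i).indicator (fun _ => 1) x := by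
  have hd := hV.scale_pos (i + 1)
  rw [hV.step i]
  by_cases hx : x ∈ changeZone μ c E V δ i
  · rw [indicator_of_mem hx, mul_one]
    exact abs_pushStep_sub_le j x
  · rw [indicator_of_notMem hx, mul_zero]
    rw [pushStep_eq_of_notMem hd, sub_self, abs_zero]
    exact fun h => hx (iUnion_mono (fun j => thickening_mono (by linarith) _) h)

/-- Pointwise bound on the number of times `V j` is pushed down by a full unit at `x`: each push is
accounted for either by the excess of the density of `E j` over the initial value of `V j`, or by
the excess over the maximal value `M` after one of the raises. -/
lemma sum_indicator_push_le (hV : IsPushSequence μ c M E V δ) (hc : 1 < c) (j : Fin N) (x : X)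
    (l : ℕ) : ∀ k n : ℕ, n = k + l →
    ∑ i ∈ Finset.Ico k n, (thickening (δ (i + 1)) (pushSet μ c E (V i) (δ (i + 1)) j)).indicator
      (fun _ => (1 : ℝ≥0∞)) x ≤
    excess μ c (E j) (8 * δ (k + 1)) (V k j x) x +
    ∑ i ∈ Finset.Ico k n, (raiseZone μ c M E (V i) (δ (i + 1)) j).indicator
      (excess μ c (E j) (8 * δ (i + 2)) M) x := by
  induction l with
  | zero => intro k n hn; simp [hn]
  | succ l ih =>
    intro k n hn
    have hkn : k < n := by omega
    rw [Finset.sum_eq_sum_Ico_succ_bot hkn, Finset.sum_eq_sum_Ico_succ_bot hkn]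
    have h := ih (k + 1) n (by omega)
    have hd := hV.scale_pos (k + 1)
    have hmem := fun hx => (hV.admissible k).mem_denseBalls (x := x) (j := j) hc hd
      (hV.scale_le (Nat.le_succ k)) hx
    have hδ : 8 * δ (k + 1 + 1) ≤ 8 * δ (k + 1) := by
      have := hV.scale_le (Nat.le_succ (k + 1)); linarith
    set T := thickening (δ (k + 1)) (pushSet μ c E (V k) (δ (k + 1)) j)
    by_cases hR : x ∈ raiseZone μ c M E (V k) (δ (k + 1)) j
    · rw [indicator_of_mem hR]
      have h1 : T.indicator (fun _ => (1 : ℝ≥0∞)) x ≤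
          excess μ c (E j) (8 * δ (k + 1)) (V k j x) x := by
        by_cases hT : x ∈ T
        · rw [indicator_of_mem hT, excess_eq_add _ (hmem hT)]
          exact le_self_add
        · rw [indicator_of_notMem hT]; exact zero_le
      have h2 : excess μ c (E j) (8 * δ (k + 1 + 1)) (V (k + 1) j x) x ≤
          excess μ c (E j) (8 * δ (k + 2)) M x :=
        excess_mono hc _ le_rfl (hV.le_sum _ _ _) x
      rw [← add_assoc] at *
      exact (add_le_add h1 (h.trans (add_le_add_left h2 _))).trans_eq (by ring)
    · rw [indicator_of_notMem hR, zero_add]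
      have hle := pushStep_le hd hR
      rw [← hV.step k] at hle
      have h1 : T.indicator (fun _ => (1 : ℝ≥0∞)) x +
          excess μ c (E j) (8 * δ (k + 1 + 1)) (V (k + 1) j x) x ≤
          excess μ c (E j) (8 * δ (k + 1)) (V k j x) x := by
        by_cases hT : x ∈ T
        · rw [indicator_of_mem hT] at hle ⊢
          rw [excess_eq_add _ (hmem hT)]
          gcongr
          exact excess_mono hc _ hδ hle x
        · rw [indicator_of_notMem hT] at hle ⊢
          rw [zero_add]
          exact excess_mono hc _ hδ (by linarith) x
      calc _ ≤ T.indicator (fun _ => (1 : ℝ≥0∞)) x +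
            (excess μ c (E j) (8 * δ (k + 1 + 1)) (V (k + 1) j x) x + _) := by
              gcongr
        _ ≤ _ := by
              rw [← add_assoc]
              gcongr

variable [BorelSpace X]

lemma measure_thickening_inter_ball_le (hV : IsPushSequence μ c M E V δ) (hμ : IsDoublingWith μ c)
    {k i : ℕ} (hki : k ≤ i) (z : X) (S : Set X) :
    μ (thickening (4 * δ (i + 1)) S ∩ ball z (δ k)) ≤
      epow c 5 * μ (thickening (δ (i + 1)) S ∩ ball z (2 * δ k)) := by
  have hc := hμ.one_lt
  have hd := hV.scale_pos (i + 1)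
  have hdk : 16 * δ (i + 1) ≤ δ k := by rw [← hV.scale_succ]; exact hV.scale_le hki
  set d := δ (i + 1)
  set P : Set (X × ℝ) := {p | p.1 ∈ S ∧ p.2 = 4 * d ∧ (ball p.1 (4 * d) ∩ ball z (δ k)).Nonempty}
  have key := hμ.measure_iUnion_ball_le (ν := μ) (ν' := μ.restrict (thickening d S))
    (κ := epow c 5) P (4 * d) (by rintro p ⟨-, h, -⟩; exact ⟨by rw [h]; positivity, h.le⟩) (by
      rintro ⟨y, t⟩ ⟨hy, ht, -⟩
      simp only at hy ht ⊢
      subst ht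
      refine (hμ.measure_ball_le hd 4 5 (by norm_num; linarith)
        (by rw [dist_self]; positivity)).trans ?_
      rw [Measure.restrict_apply measurableSet_ball]
      refine mul_le_mul_right (measure_mono fun w hw => ?_) _
      refine ⟨ball_subset_ball (by linarith) hw, ?_⟩
      exact mem_thickening_iff.2 ⟨y, hy, hw⟩)
  calc _ ≤ μ (⋃ p ∈ P, ball p.1 p.2) := by
        refine measure_mono ?_
        rintro x ⟨hx, hxz⟩
        obtain ⟨y, hy, hxy⟩ := mem_thickening_iff.1 hx
        exact mem_biUnion (show (y, 4 * d) ∈ P from ⟨hy, rfl, ⟨x, hxy, hxz⟩⟩) hxy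
    _ ≤ _ := key
    _ ≤ _ := by
        rw [Measure.restrict_apply (isOpen_biUnion fun _ _ => isOpen_ball).measurableSet,
          inter_comm]
        gcongr
        refine iUnion₂_subset ?_
        rintro ⟨y, t⟩ ⟨-, ht, ⟨w, hw1, hw2⟩⟩
        simp only at ht hw1 ⊢
        subst ht
        refine ball_subset_ball' ?_
        rw [mem_ball] at hw1 hw2
        have := dist_triangle_left y z w
        linarith

lemma setLIntegral_initial_excess_le (hV : IsPushSequence μ c M E V δ) (hμ : IsDoublingWith μ c)
    (k : ℕ) (j : Fin N) (z : X) :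
    ∫⁻ x in ball z (2 * δ k), excess μ c (E j) (8 * δ (k + 1)) (V k j x) x ∂μ ≤
      epow c (12 * stepLip N + 6) * (1 - epow c (-4))⁻¹ * μ (ball z (δ k)) := by
  have hc := hμ.one_lt
  have hd := hV.scale_pos k
  have hd1 := hV.scale_succ k
  have hL := stepLip_pos N
  calc ∫⁻ x in ball z (2 * δ k), excess μ c (E j) (8 * δ (k + 1)) (V k j x) x ∂μ
      ≤ ∫⁻ x in ball z (2 * δ k),
          excess μ c (E j) (8 * δ (k + 1)) (V k j z + 2 * stepLip N) x ∂μ := by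
        refine setLIntegral_mono (measurable_excess _ _ _) fun x hx => ?_
        refine excess_mono hc _ le_rfl ?_ x
        have h1 := (abs_le.1 ((hV.admissible k).lip j x z)).2
        have h2 : stepLip N / δ k * dist x z ≤ 2 * stepLip N := by
          rw [div_mul_eq_mul_div, div_le_iff₀ hd]
          rw [mem_ball] at hx
          nlinarith
        linarith
    _ ≤ epow c (4 * (V k j z + 2 * stepLip N - 1) + 3) * (1 - epow c (-4))⁻¹ *
          μ (E j ∩ ball z (3 * (2 * δ k))) :=
        hμ.setLIntegral_excess_le _ _ _ (by linarith)
    _ ≤ epow c (4 * (V k j z + 2 * stepLip N - 1) + 3) * (1 - epow c (-4))⁻¹ *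
          (epow c (4 * (stepLip N + 1 - V k j z)) * (epow c 3 * μ (ball z (δ k)))) := by
        gcongr
        calc μ (E j ∩ ball z (3 * (2 * δ k))) ≤ μ (E j ∩ ball z (8 * δ k)) := by
              exact measure_mono (inter_subset_inter_right _ (ball_subset_ball (by linarith)))
          _ ≤ _ := (hV.admissible k).density j z
          _ ≤ _ := by
              gcongr
              exact hμ.measure_ball_le hd 2 3 (by norm_num) (by rw [dist_self]; positivity)
    _ = epow c (4 * (V k j z + 2 * stepLip N - 1) + 3) * epow c (4 * (stepLip N + 1 - V k j z)) *
          epow c 3 * (1 - epow c (-4))⁻¹ * μ (ball z (δ k)) := by ring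
    _ = _ := by
        rw [← epow.add hc, ← epow.add hc]
        congr 3
        ring

/-- A function is only raised where its set is very sparse, so that pushes following a raise are
rare. -/
lemma setLIntegral_raise_excess_le (hV : IsPushSequence μ c M E V δ) (hμ : IsDoublingWith μ c)
    {k i : ℕ} (hki : k ≤ i) (j : Fin N) (z : X) :
    ∫⁻ x in ball z (2 * δ k), (raiseZone μ c M E (V i) (δ (i + 1)) j).indicator
      (excess μ c (E j) (8 * δ (i + 2)) M) x ∂μ ≤
      epow c (6 - 4 * M) * (1 - epow c (-4))⁻¹ *
        μ (changeZone μ c E V δ i ∩ ball z (3 * δ k)) := by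
  have hc := hμ.one_lt
  have hd := hV.scale_pos (i + 1)
  have hd2 := hV.scale_succ (i + 1)
  have hdk : 16 * δ (i + 1) ≤ δ k := by rw [← hV.scale_succ]; exact hV.scale_le hki
  have hW := (isOpen_changeZone μ c E V δ i).measurableSet
  set d := δ (i + 1)
  set R := raiseZone μ c M E (V i) d j
  have hRm : MeasurableSet R := (isOpen_raiseZone j).measurableSet
  have key := hμ.measure_le_of_forall_ball
    (ν := μ.withDensity (R.indicator (excess μ c (E j) (8 * δ (i + 2)) M)))
    (ν' := μ.restrict (changeZone μ c E V δ i))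
    (κ := epow c (6 - 4 * M) * (1 - epow c (-4))⁻¹) (Y := ball z (2 * δ k))
    (U := ball z (3 * δ k)) (t := d / 8) (by positivity) (fun x _ => ?_)
    (fun x hx => ball_subset_ball' (by rw [mem_ball] at hx; linarith))
  · rwa [withDensity_apply _ measurableSet_ball, Measure.restrict_apply measurableSet_ball,
      inter_comm] at key
  · rw [mul_div_cancel₀ d (by norm_num : (8 : ℝ) ≠ 0), withDensity_apply _ measurableSet_ball]
    by_cases hne : (ball x d ∩ R).Nonempty
    · obtain ⟨y, hyx, hyR⟩ := hne
      rw [mem_ball] at hyx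
      have hsub : ball x (d / 8) ⊆ changeZone μ c E V δ i := by
        intro w hw
        obtain ⟨j', hj'⟩ := mem_iUnion.1 hyR.1
        obtain ⟨v, hv, hyv⟩ := mem_thickening_iff.1 hj'
        refine mem_iUnion.2 ⟨j', mem_thickening_iff.2 ⟨v, hv, ?_⟩⟩
        rw [mem_ball] at hw
        have h4 : dist w v ≤ dist w x + dist x y + dist y v := dist_triangle4 _ _ _ _
        rw [dist_comm x y] at h4
        change dist w v < 4 * d
        linarith
      rw [Measure.restrict_apply measurableSet_ball, inter_eq_left.2 hsub]
      calc ∫⁻ x in ball x d, R.indicator (excess μ c (E j) (8 * δ (i + 2)) M) x ∂μ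
          ≤ ∫⁻ x in ball x d, excess μ c (E j) (8 * δ (i + 2)) M x ∂μ :=
            lintegral_mono fun w => indicator_le_self _ _ w
        _ ≤ epow c (4 * (M - 1) + 3) * (1 - epow c (-4))⁻¹ * μ (E j ∩ ball x (3 * d)) :=
            hμ.setLIntegral_excess_le _ _ _ (by
              change d = 16 * δ (i + 2) at hd2
              linarith)
        _ ≤ epow c (4 * (M - 1) + 3) * (1 - epow c (-4))⁻¹ *
            (epow c (1 - 8 * M) * (epow c 6 * μ (ball x (d / 8)))) := by
            gcongr
            calc μ (E j ∩ ball x (3 * d)) ≤ μ (E j ∩ ball y (8 * d)) := by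
                  gcongr
                  exact ball_subset_ball' (by rw [dist_comm]; linarith)
              _ ≤ _ := measure_inter_ball_le_of_mem_thickening hμ hd hyR.2
              _ ≤ _ := by
                  gcongr
                  exact hμ.measure_ball_le (by positivity) 5 6 (by norm_num; linarith)
                    (by norm_num; linarith)
        _ = epow c (4 * (M - 1) + 3) * epow c (1 - 8 * M) * epow c 6 * (1 - epow c (-4))⁻¹ *
              μ (ball x (d / 8)) := by ring
        _ = _ := by
            rw [← epow.add hc, ← epow.add hc]
            congr 3
            ring
    · have h0 : ∫⁻ x in ball x d, R.indicator (excess μ c (E j) (8 * δ (i + 2)) M) x ∂μ = 0 := by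
        rw [setLIntegral_congr_fun measurableSet_ball (g := fun _ => 0)]
        · simp
        · intro w hw
          exact indicator_of_notMem (fun h => hne ⟨w, hw, h⟩) _
      rw [h0]
      exact zero_le

/-- The packing estimate: the change zones at the scales below `δ k` have bounded overlap on
average over each ball of radius `δ k`. -/
lemma sum_measure_changeZone_le (hV : IsPushSequence μ c M E V δ) (hμ : IsDoublingWith μ c)
    {Q : ℝ≥0∞}
    (hQ : N * (epow c 5 * (epow c (12 * stepLip N + 6) * (1 - epow c (-4))⁻¹ +
      epow c (6 - 4 * M) * (1 - epow c (-4))⁻¹ * ((1 + Q * epow c 3) * epow c 2))) ≤ Q) (l : ℕ) :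
    ∀ (k n : ℕ), n = k + l → ∀ z : X,
      ∑ i ∈ Finset.Ico k n, μ (changeZone μ c E V δ i ∩ ball z (δ k)) ≤ Q * μ (ball z (δ k)) := by
  have hc := hμ.one_lt
  induction l with
  | zero => intro k n hn z; simp [hn]
  | succ l ih =>
    intro k n hn z
    have hkn : k < n := by omega
    have hd := hV.scale_pos k
    have hd1 := hV.scale_pos (k + 1)
    have hd2 := hV.scale_succ k
    set W := changeZone μ c E V δ with hW
    have hWm : ∀ i, MeasurableSet (W i) := fun i => (isOpen_changeZone μ c E V δ i).measurableSet
    set G := (1 - epow c (-4))⁻¹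
    set B := ball z (δ k)
    -- the same sum over a larger ball, by covering it with balls of the next scale
    have hbig : ∑ i ∈ Finset.Ico k n, μ (W i ∩ ball z (3 * δ k)) ≤
        (1 + Q * epow c 3) * epow c 2 * μ B := by
      have hcov := hμ.measure_le_of_forall_ball
        (ν := ∑ i ∈ Finset.Ico (k + 1) n, μ.restrict (W i)) (ν' := μ) (κ := Q * epow c 3)
        (Y := ball z (3 * δ k)) (U := ball z (4 * δ k)) (t := δ (k + 1) / 8) (by positivity)
        (fun x _ => by
          rw [mul_div_cancel₀ _ (by norm_num : (8 : ℝ) ≠ 0), Measure.finsetSum_apply]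
          simp only [Measure.restrict_apply measurableSet_ball, inter_comm (ball x _)]
          refine (ih (k + 1) n (by omega) x).trans ?_
          rw [mul_assoc]
          gcongr
          exact hμ.measure_ball_le (by positivity) 2 3 (by norm_num; linarith)
            (by rw [dist_self]; positivity))
        (fun x hx => ball_subset_ball' (by rw [mem_ball] at hx; linarith))
      rw [Measure.finsetSum_apply] at hcov
      simp only [Measure.restrict_apply measurableSet_ball, inter_comm (ball z _)] at hcov
      have h4 : ∀ t ≤ 4 * δ k, μ (ball z t) ≤ epow c 2 * μ B := fun t ht =>
        hμ.measure_ball_le hd 1 2 (by norm_num; linarith) (by rw [dist_self]; positivity)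
      rw [Finset.sum_eq_sum_Ico_succ_bot hkn]
      calc _ ≤ μ (ball z (3 * δ k)) + Q * epow c 3 * μ (ball z (4 * δ k)) :=
            add_le_add (measure_mono inter_subset_right) hcov
        _ ≤ epow c 2 * μ B + Q * epow c 3 * (epow c 2 * μ B) := by
            gcongr
            · exact h4 _ (by linarith)
            · exact h4 _ le_rfl
        _ = _ := by ring
    set T := fun i j => thickening (δ (i + 1)) (pushSet μ c E (V i) (δ (i + 1)) j)
    have hTm : ∀ i j, MeasurableSet (T i j) := fun i j => isOpen_thickening.measurableSet
    have hRm : ∀ i j, Measurable ((raiseZone μ c M E (V i) (δ (i + 1)) j).indicator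
        (excess μ c (E j) (8 * δ (i + 2)) M)) := fun i j =>
      (measurable_excess _ _ _).indicator (isOpen_raiseZone j).measurableSet
    have hpush : ∀ j, ∑ i ∈ Finset.Ico k n, μ (T i j ∩ ball z (2 * δ k)) ≤
        (epow c (12 * stepLip N + 6) * G + epow c (6 - 4 * M) * G *
          ((1 + Q * epow c 3) * epow c 2)) * μ B := by
      intro j
      calc ∑ i ∈ Finset.Ico k n, μ (T i j ∩ ball z (2 * δ k))
          = ∫⁻ x in ball z (2 * δ k), ∑ i ∈ Finset.Ico k n,
              (T i j).indicator (fun _ => (1 : ℝ≥0∞)) x ∂μ := by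
            rw [lintegral_finsetSum _ fun i _ => measurable_const.indicator (hTm i j)]
            refine Finset.sum_congr rfl fun i _ => ?_
            rw [lintegral_indicator (hTm i j), setLIntegral_one, Measure.restrict_apply (hTm i j)]
        _ ≤ ∫⁻ x in ball z (2 * δ k), (excess μ c (E j) (8 * δ (k + 1)) (V k j x) x +
              ∑ i ∈ Finset.Ico k n, (raiseZone μ c M E (V i) (δ (i + 1)) j).indicator
                (excess μ c (E j) (8 * δ (i + 2)) M) x) ∂μ :=
            lintegral_mono fun x => hV.sum_indicator_push_le hc j x (l + 1) k n hn
        _ = ∫⁻ x in ball z (2 * δ k), excess μ c (E j) (8 * δ (k + 1)) (V k j x) x ∂μ +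
              ∑ i ∈ Finset.Ico k n, ∫⁻ x in ball z (2 * δ k),
                (raiseZone μ c M E (V i) (δ (i + 1)) j).indicator
                (excess μ c (E j) (8 * δ (i + 2)) M) x ∂μ := by
            rw [lintegral_add_right _ (Finset.measurable_sum _ fun i _ => hRm i j),
              lintegral_finsetSum _ fun i _ => hRm i j]
        _ ≤ epow c (12 * stepLip N + 6) * G * μ B + ∑ i ∈ Finset.Ico k n,
              epow c (6 - 4 * M) * G * μ (W i ∩ ball z (3 * δ k)) := by
            refine add_le_add (hV.setLIntegral_initial_excess_le hμ k j z)
              (Finset.sum_le_sum fun i hi => ?_)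
            exact hV.setLIntegral_raise_excess_le hμ (Finset.mem_Ico.1 hi).1 j z
        _ ≤ epow c (12 * stepLip N + 6) * G * μ B + epow c (6 - 4 * M) * G *
              ((1 + Q * epow c 3) * epow c 2 * μ B) := by
            rw [← Finset.mul_sum]
            gcongr
        _ = _ := by ring
    calc ∑ i ∈ Finset.Ico k n, μ (W i ∩ B)
        ≤ ∑ i ∈ Finset.Ico k n, ∑ j, epow c 5 * μ (T i j ∩ ball z (2 * δ k)) := by
          refine Finset.sum_le_sum fun i hi => ?_
          rw [hW, changeZone, iUnion_inter]
          refine (measure_iUnion_fintype_le _ _).trans (Finset.sum_le_sum fun j _ => ?_)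
          exact hV.measure_thickening_inter_ball_le hμ (Finset.mem_Ico.1 hi).1 z _
      _ = ∑ j, epow c 5 * ∑ i ∈ Finset.Ico k n, μ (T i j ∩ ball z (2 * δ k)) := by
          rw [Finset.sum_comm]
          simp only [Finset.mul_sum]
      _ ≤ ∑ _j : Fin N, epow c 5 * ((epow c (12 * stepLip N + 6) * G + epow c (6 - 4 * M) * G *
          ((1 + Q * epow c 3) * epow c 2)) * μ B) := by
          gcongr with j
          exact hpush j
      _ = N * (epow c 5 * (epow c (12 * stepLip N + 6) * G + epow c (6 - 4 * M) * G *
          ((1 + Q * epow c 3) * epow c 2))) * μ B := by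
          rw [Finset.sum_const, Finset.card_univ, Fintype.card_fin, nsmul_eq_mul]
          ring
      _ ≤ Q * μ B := by gcongr

end IsPushSequence

end

/-! ### Families over all scales -/

section

/-- Pointwise convergence on a dense set and a common Lipschitz bound imply pointwise
convergence. -/
lemma exists_tendsto_of_dense_of_lipschitz {X : Type*} [MetricSpace X] {u : ℕ → X → ℝ} {L : ℝ}
    (hL : 0 < L) (hu : ∀ᶠ n in atTop, ∀ x y, |u n x - u n y| ≤ L * dist x y) {D : Set X}
    (hD : Dense D) (h : ∀ y ∈ D, ∃ l, Tendsto (fun n => u n y) atTop (𝓝 l)) (x : X) :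
    ∃ l, Tendsto (fun n => u n x) atTop (𝓝 l) := by
  refine cauchySeq_tendsto_of_complete (Metric.cauchySeq_iff.2 fun ε hε => ?_)
  obtain ⟨y, hyD, hy⟩ := hD.exists_dist_lt x (by positivity : 0 < ε / (3 * L))
  obtain ⟨l, hl⟩ := h y hyD
  obtain ⟨n₁, h₁⟩ := Metric.cauchySeq_iff.1 hl.cauchySeq (ε / 3) (by positivity)
  obtain ⟨n₂, h₂⟩ := eventually_atTop.1 hu
  refine ⟨max n₁ n₂, fun m hm n hn => ?_⟩
  have e1 := h₁ m (le_trans (le_max_left _ _) hm) n (le_trans (le_max_left _ _) hn)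
  have e2 := h₂ m (le_trans (le_max_right _ _) hm) x y
  have e3 := h₂ n (le_trans (le_max_right _ _) hn) x y
  have e4 : L * dist x y < ε / 3 := by
    rw [lt_div_iff₀ (by positivity)] at hy
    linarith
  rw [Real.dist_eq] at e1 ⊢
  rw [abs_lt] at *
  rw [abs_le] at *
  constructor <;> linarith [e1.1, e1.2, e2.1, e2.2, e3.1, e3.2]

variable {X : Type*} [MetricSpace X] [MeasurableSpace X] {N : ℕ}

section Start

variable {μ : Measure X} {c M : ℝ} {E : Fin N → Set X}

/-- If one of the sets is everywhere sparse at the initial scale, then the construction can be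
started with a constant family. -/
lemma exists_isPushSequence (hμ : IsDoublingWith μ c) (hM : 0 < M)
    (hmin : ∀ (x : X) (r : ℝ), 0 < r →
      ∃ j, μ (E j ∩ ball x r) ≤ epow c (-(8 * M)) * μ (ball x r))
    {δ : ℕ → ℝ} (hδ : ∀ i, 0 < δ i) (hδ' : ∀ i, δ i = 16 * δ (i + 1)) (j₀ : Fin N)
    (hj₀ : ∀ y, μ (E j₀ ∩ ball y (8 * δ 0)) ≤ epow c (1 - 8 * M) * μ (ball y (8 * δ 0))) :
    ∃ V, IsPushSequence μ c M E V δ := by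
  have hc := hμ.one_lt
  have hL := stepLip_pos N
  set V : ℕ → Fin N → X → ℝ := fun n => Nat.rec (fun j _ => if j = j₀ then M else 0)
    (fun i v => pushStep μ c M E (δ (i + 1)) v) n
  have h0 : IsAdmissible μ c M E (V 0) (δ 0) := by
    refine ⟨fun j x => ?_, fun x => ?_, fun j x y => ?_, fun j y => ?_⟩
    · change 0 ≤ if j = j₀ then M else 0
      split_ifs <;> linarith
    · change ∑ j, (if j = j₀ then M else 0) = M
      simp
    · change |(if j = j₀ then M else 0) - (if j = j₀ then M else 0)| ≤ _
      rw [sub_self, abs_zero]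
      have := hδ 0
      positivity
    · change _ ≤ epow c (4 * (stepLip N + 1 - if j = j₀ then M else 0)) * _
      split_ifs with h
      · subst h
        refine (hj₀ y).trans ?_
        gcongr
        exact epow.mono hc (by linarith)
      · refine (measure_mono inter_subset_right).trans ?_
        exact le_mul_of_one_le_left zero_le (epow.one_le hc (by linarith))
  have hall : ∀ i, IsAdmissible μ c M E (V i) (δ i) := by
    intro i
    induction i with
    | zero => exact h0
    | succ i ih => exact ih.pushStep hμ hM (hδ i) (hδ' i) hmin
  exact ⟨V, hδ, hδ', hall, fun _ => rfl⟩

end Start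

/-- A family of `[0, M]`-valued functions indexed by all the scales `16 ^ (-m)`, `m ∈ ℤ`, with the
properties of the construction: Lipschitz bounds, the density bound, and total variation across the
scales at most `N * Q` on average over each ball. -/
structure IsScaleFamily (μ : Measure X) (c M : ℝ) (Q : ℝ≥0∞) (E : Fin N → Set X)
    (W : ℤ → Fin N → X → ℝ) : Prop where
  nonneg : ∀ m j x, 0 ≤ W m j x
  sum_eq : ∀ m x, ∑ j, W m j x = M
  lip : ∀ m j x y, |W m j x - W m j y| ≤ stepLip N / 16 ^ (-m) * dist x y
  density : ∀ m j y, μ (E j ∩ ball y (8 * 16 ^ (-m))) ≤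
    epow c (4 * (stepLip N + 1 - W m j y)) * μ (ball y (8 * 16 ^ (-m)))
  variation : ∀ m j z (l : ℕ), ∫⁻ x in ball z (16 ^ (-m)),
    ∑ i ∈ Finset.range l, ‖W (m + i + 1) j x - W (m + i) j x‖ₑ ∂μ ≤
      N * Q * μ (ball z (16 ^ (-m)))

variable {μ : Measure X} {c M : ℝ} {E : Fin N → Set X}

lemma IsAdmissible.continuous {V : Fin N → X → ℝ} {δ : ℝ} (hV : IsAdmissible μ c M E V δ)
    (hδ : 0 < δ) (j : Fin N) : Continuous (V j) := by
  have hL := stepLip_pos N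
  refine (LipschitzWith.of_dist_le_mul (K := (stepLip N / δ).toNNReal) fun x y => ?_).continuous
  rw [Real.coe_toNNReal _ (by positivity)]
  exact hV.lip j x y

variable [BorelSpace X]

/-- The packing estimate bounds the variation of the functions across the scales. -/
lemma IsPushSequence.setLIntegral_sum_enorm_sub_le {V : ℕ → Fin N → X → ℝ} {δ : ℕ → ℝ}
    (hV : IsPushSequence μ c M E V δ) (hμ : IsDoublingWith μ c) {Q : ℝ≥0∞}
    (hQ : N * (epow c 5 * (epow c (12 * stepLip N + 6) * (1 - epow c (-4))⁻¹ +
      epow c (6 - 4 * M) * (1 - epow c (-4))⁻¹ * ((1 + Q * epow c 3) * epow c 2))) ≤ Q)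
    (k l : ℕ) (j : Fin N) (z : X) :
    ∫⁻ x in ball z (δ k), ∑ i ∈ Finset.range l, ‖V (k + i + 1) j x - V (k + i) j x‖ₑ ∂μ ≤
      N * Q * μ (ball z (δ k)) := by
  have hWm : ∀ i, MeasurableSet (changeZone μ c E V δ i) := fun i =>
    (isOpen_changeZone μ c E V δ i).measurableSet
  calc ∫⁻ x in ball z (δ k), ∑ i ∈ Finset.range l, ‖V (k + i + 1) j x - V (k + i) j x‖ₑ ∂μ
      ≤ ∫⁻ x in ball z (δ k), ∑ i ∈ Finset.range l,
          (changeZone μ c E V δ (k + i)).indicator (fun _ => (N : ℝ≥0∞)) x ∂μ := by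
        refine lintegral_mono fun x => Finset.sum_le_sum fun i _ => ?_
        have h := hV.abs_sub_le_indicator (k + i) j x
        rw [← ofReal_norm, Real.norm_eq_abs]
        by_cases hx : x ∈ changeZone μ c E V δ (k + i)
        · rw [indicator_of_mem hx] at h ⊢
          refine (ENNReal.ofReal_le_ofReal h).trans ?_
          simp
        · rw [indicator_of_notMem hx] at h ⊢
          refine (ENNReal.ofReal_le_ofReal h).trans ?_
          simp
    _ = N * ∑ i ∈ Finset.Ico k (k + l), μ (changeZone μ c E V δ i ∩ ball z (δ k)) := by
        rw [lintegral_finsetSum _ fun i _ => measurable_const.indicator (hWm _),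
          Finset.sum_Ico_eq_sum_range, add_tsub_cancel_left, Finset.mul_sum]
        refine Finset.sum_congr rfl fun i _ => ?_
        rw [lintegral_indicator (hWm _), setLIntegral_const, Measure.restrict_apply (hWm _)]
    _ ≤ N * (Q * μ (ball z (δ k))) := by
        gcongr
        exact hV.sum_measure_changeZone_le hμ hQ l k _ rfl z
    _ = _ := (mul_assoc _ _ _).symm

/-- Existence of the family over all scales. The sets are first truncated to a large ball, whose
sparsest set provides the initial constant family at the scale of that ball; a limit is then taken
as the radius of the ball tends to infinity. -/
theorem exists_isScaleFamily (hμ : IsDoublingWith μ c) (hM : 0 < M)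
    (hmin : ∀ (x : X) (r : ℝ), 0 < r →
      ∃ j, μ (E j ∩ ball x r) ≤ epow c (-(8 * M)) * μ (ball x r)) {Q : ℝ≥0∞}
    (hQ : N * (epow c 5 * (epow c (12 * stepLip N + 6) * (1 - epow c (-4))⁻¹ +
      epow c (6 - 4 * M) * (1 - epow c (-4))⁻¹ * ((1 + Q * epow c 3) * epow c 2))) ≤ Q) :
    ∃ W, IsScaleFamily μ c M Q E W := by
  have hc := hμ.one_lt
  have hL := stepLip_pos N
  rcases isEmpty_or_nonempty X with hX | ⟨⟨x₀⟩⟩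
  · exact ⟨fun _ _ _ => 0, fun _ _ x => hX.elim x, fun _ x => hX.elim x, fun _ _ x => hX.elim x,
      fun _ _ x => hX.elim x, fun _ _ x => hX.elim x⟩
  have := hμ.secondCountableTopology
  have : Nonempty X := ⟨x₀⟩
  set δ : ℕ → ℕ → ℝ := fun K i => 16 ^ ((K : ℤ) - i) with hδ
  have hδ0 : ∀ K i, 0 < δ K i := fun K i => by positivity
  have hδ1 : ∀ K i, δ K i = 16 * δ K (i + 1) := fun K i => by
    simp only [hδ]
    rw [← zpow_one_add₀ (by norm_num)]
    congr 1
    push_cast; ring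
  set F : ℕ → Fin N → Set X := fun K j => E j ∩ ball x₀ (16 * 16 ^ K)
  have hFE : ∀ K j, F K j ⊆ E j := fun K j => inter_subset_left
  have hex : ∀ K, ∃ V, IsPushSequence μ c M (F K) V (δ K) := by
    intro K
    obtain ⟨j₀, hj₀⟩ := hmin x₀ (16 * 16 ^ K) (by positivity)
    refine exists_isPushSequence hμ hM (fun x r hr => ?_) (hδ0 K) (hδ1 K) j₀ fun y => ?_
    · obtain ⟨j, hj⟩ := hmin x r hr
      exact ⟨j, (measure_mono (inter_subset_inter_left _ (hFE K j))).trans hj⟩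
    · have hδK : δ K 0 = 16 ^ K := by simp [hδ]
      rw [hδK]
      by_cases hne : (ball x₀ (2 * (8 * 16 ^ K)) ∩ ball y (8 * 16 ^ K)).Nonempty
      · have h1 := hμ.doubling x₀ y (8 * 16 ^ K) (by positivity) hne
        rw [← epow.one, show (2 : ℝ) * (8 * 16 ^ K) = 16 * 16 ^ K by ring] at h1
        calc μ (F K j₀ ∩ ball y (8 * 16 ^ K)) ≤ μ (E j₀ ∩ ball x₀ (16 * 16 ^ K)) :=
              measure_mono inter_subset_left
          _ ≤ _ := hj₀
          _ ≤ epow c (-(8 * M)) * (epow c 1 * μ (ball y (8 * 16 ^ K))) := by gcongr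
          _ = _ := by
              rw [← mul_assoc, ← epow.add hc]
              congr 2; ring
      · have : F K j₀ ∩ ball y (8 * 16 ^ K) = ∅ := by
          rw [eq_empty_iff_forall_notMem]
          rintro w ⟨⟨-, hw⟩, hw'⟩
          refine hne ⟨w, ?_, hw'⟩
          rwa [show (2 : ℝ) * (8 * 16 ^ K) = 16 * 16 ^ K by ring]
        rw [this, measure_empty]
        exact zero_le
  choose V hV using hex
  set v : ℕ → ℤ → Fin N → X → ℝ := fun K m j x => V K (m + K).toNat j x with hv
  -- once `K` is large, `v K m` is at scale `16 ^ (-m)`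
  have hscale : ∀ (K : ℕ) (m : ℤ), 0 ≤ m + K → δ K (m + K).toNat = 16 ^ (-m) := fun K m h => by
    simp only [hδ]
    rw [Int.toNat_of_nonneg h]
    congr 1
    ring
  have hadm : ∀ (K : ℕ) (m : ℤ), 0 ≤ m + K → IsAdmissible μ c M (F K) (v K m) (16 ^ (-m)) :=
    fun K m h => by
      rw [← hscale K m h]
      exact (hV K).admissible _
  have hv0 : ∀ K m j x, 0 ≤ v K m j x := fun K m j x => ((hV K).admissible _).nonneg j x
  have hvM : ∀ K m j x, v K m j x ≤ M := fun K m j x => (hV K).le_sum _ j x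
  have hvc : ∀ K m j, Continuous (v K m j) := fun K m j =>
    ((hV K).admissible _).continuous (hδ0 K _) j
  have hvs : ∀ K m x, ∑ j, v K m j x = M := fun K m x => ((hV K).admissible _).sum_eq x
  -- a subsequence converging on a countable dense set
  obtain ⟨a, -, φ, hφ, ha⟩ := (isCompact_univ_pi fun _ : ℤ × Fin N × ℕ =>
    isCompact_Icc (a := (0 : ℝ)) (b := M)).tendsto_subseq
    (x := fun K p => v K p.1 p.2.1 (TopologicalSpace.denseSeq X p.2.2))
    (fun K p _ => ⟨hv0 _ _ _ _, hvM _ _ _ _⟩)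
  rw [tendsto_pi_nhds] at ha
  have hφt : Tendsto φ atTop atTop := hφ.tendsto_atTop
  have hlarge : ∀ m : ℤ, ∀ᶠ n in atTop, 0 ≤ m + φ n := fun m => by
    filter_upwards [hφt.eventually_ge_atTop (-m).toNat] with n hn
    omega
  have hconv : ∀ m j x, ∃ w, Tendsto (fun n => v (φ n) m j x) atTop (𝓝 w) := by
    intro m j
    refine exists_tendsto_of_dense_of_lipschitz (L := stepLip N / 16 ^ (-m)) (by positivity) ?_
      (TopologicalSpace.denseRange_denseSeq X) ?_
    · filter_upwards [hlarge m] with n hn x y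
      exact (hadm _ m hn).lip j x y
    · rintro _ ⟨i, rfl⟩
      exact ⟨_, ha (m, j, i)⟩
  choose W hW using hconv
  refine ⟨W, fun m j x => ge_of_tendsto' (hW m j x) fun n => hv0 _ _ _ _, fun m x => ?_,
    fun m j x y => ?_, fun m j y => ?_, fun m j z l => ?_⟩
  · refine tendsto_nhds_unique (tendsto_finsetSum _ fun j _ => hW m j x) ?_
    simp only [hvs]
    exact tendsto_const_nhds
  · refine le_of_tendsto ((hW m j x).sub (hW m j y)).abs ?_
    filter_upwards [hlarge m] with n hn
    exact (hadm _ m hn).lip j x y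
  · have hr : (0 : ℝ) < 8 * 16 ^ (-m) := by positivity
    have hlim : Tendsto (fun n => epow c (4 * (stepLip N + 1 - v (φ n) m j y)) *
        μ (ball y (8 * 16 ^ (-m)))) atTop
        (𝓝 (epow c (4 * (stepLip N + 1 - W m j y)) * μ (ball y (8 * 16 ^ (-m))))) := by
      refine ENNReal.Tendsto.mul_const ?_ (Or.inr (hμ.measure_ball_ne_top y hr))
      refine ENNReal.tendsto_ofReal
        (((Real.continuous_const_rpow (by linarith : c ≠ 0)).tendsto _).comp ?_)
      exact ((tendsto_const_nhds).sub (hW m j y)).const_mul 4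
    refine ge_of_tendsto hlim ?_
    obtain ⟨K₀, hK₀⟩ := pow_unbounded_of_one_lt (8 * 16 ^ (-m) + dist y x₀)
      (by norm_num : (1 : ℝ) < 16)
    filter_upwards [hlarge m, hφt.eventually_ge_atTop K₀] with n hn hnK
    have hsub : E j ∩ ball y (8 * 16 ^ (-m)) ⊆ F (φ n) j ∩ ball y (8 * 16 ^ (-m)) := by
      rintro w ⟨hwE, hw⟩
      refine ⟨⟨hwE, ?_⟩, hw⟩
      refine ball_subset_ball' ?_ hw
      have h1 : (16 : ℝ) ^ K₀ ≤ 16 ^ φ n := pow_le_pow_right₀ (by norm_num) hnK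
      have h2 : (0 : ℝ) < 16 ^ K₀ := by positivity
      linarith
    exact (measure_mono hsub).trans ((hadm _ m hn).density j y)
  · have hmeas : ∀ n, Measurable fun x => ∑ i ∈ Finset.range l,
        ‖v (φ n) (m + i + 1) j x - v (φ n) (m + i) j x‖ₑ := fun n =>
      Finset.measurable_fun_sum _ fun i _ =>
        ((hvc _ _ _).sub (hvc _ _ _)).measurable.enorm
    have hpt : ∀ x, ∑ i ∈ Finset.range l, ‖W (m + i + 1) j x - W (m + i) j x‖ₑ =
        liminf (fun n => ∑ i ∈ Finset.range l,
          ‖v (φ n) (m + i + 1) j x - v (φ n) (m + i) j x‖ₑ) atTop := fun x =>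
      (Tendsto.liminf_eq (tendsto_finsetSum _ fun i _ =>
        ((hW _ j x).sub (hW _ j x)).enorm)).symm
    simp only [hpt]
    refine (lintegral_liminf_le hmeas).trans ?_
    refine liminf_le_of_frequently_le' (Eventually.frequently ?_)
    filter_upwards [hlarge m] with n hn
    have h := (hV (φ n)).setLIntegral_sum_enorm_sub_le hμ hQ (m + φ n).toNat l j z
    rw [hscale _ _ hn] at h
    refine le_of_eq_of_le ?_ h
    refine lintegral_congr fun x => Finset.sum_congr rfl fun i _ => ?_
    have e1 : (m + i + 1 + φ n).toNat = (m + φ n).toNat + i + 1 := by omega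
    have e2 : (m + i + φ n).toNat = (m + φ n).toNat + i := by omega
    simp only [hv]
    rw [e1, e2]

end

/-! ### The limit functions and their BMO norm -/

section

variable {X : Type*} [MetricSpace X] [MeasurableSpace X] {N : ℕ}
  {μ : Measure X} {c M : ℝ} {Q : ℝ≥0∞} {E : Fin N → Set X} {W : ℤ → Fin N → X → ℝ}

namespace IsScaleFamily

lemma continuous (hW : IsScaleFamily μ c M Q E W) (m : ℤ) (j : Fin N) : Continuous (W m j) := by
  have hL := stepLip_pos N
  refine (LipschitzWith.of_dist_le_mul (K := (stepLip N / 16 ^ (-m)).toNNReal)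
    fun x y => ?_).continuous
  rw [Real.coe_toNNReal _ (by positivity)]
  exact hW.lip m j x y

variable [BorelSpace X]

lemma setLIntegral_tsum_le (hW : IsScaleFamily μ c M Q E W) (m : ℤ) (j : Fin N) (z : X) :
    ∫⁻ x in ball z (16 ^ (-m)), ∑' i : ℕ, ‖W (m + i + 1) j x - W (m + i) j x‖ₑ ∂μ ≤
      N * Q * μ (ball z (16 ^ (-m))) := by
  have hmeas : ∀ i : ℕ, Measurable fun x => ‖W (m + i + 1) j x - W (m + i) j x‖ₑ := fun i =>
    ((hW.continuous _ _).measurable.sub (hW.continuous _ _).measurable).enorm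
  rw [lintegral_tsum fun i => (hmeas i).aemeasurable]
  refine ENNReal.tsum_le_of_sum_range_le fun l => ?_
  rw [← lintegral_finsetSum _ fun i _ => hmeas i]
  exact hW.variation m j z l

lemma ae_tsum_ne_top (hW : IsScaleFamily μ c M Q E W) (hμ : IsDoublingWith μ c) (hQ : Q ≠ ∞)
    (j : Fin N) :
    ∀ᵐ x ∂μ, ∑' i : ℕ, ‖W (i + 1) j x - W i j x‖ₑ ≠ ∞ := by
  have := hμ.secondCountableTopology
  rw [ae_iff]
  refine measure_null_of_locally_null _ fun x _ => ?_
  refine ⟨_, inter_mem_nhdsWithin _ (ball_mem_nhds x one_pos), ?_⟩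
  have h := hW.setLIntegral_tsum_le 0 j x
  simp only [zero_add, neg_zero, zpow_zero] at h
  have hmeas : Measurable fun x => ∑' i : ℕ, ‖W (i + 1) j x - W i j x‖ₑ :=
    Measurable.tsum fun i =>
      ((hW.continuous _ _).measurable.sub (hW.continuous _ _).measurable).enorm
  have h2 := ae_lt_top hmeas (ne_top_of_le_ne_top (ENNReal.mul_ne_top
    (ENNReal.mul_ne_top (ENNReal.natCast_ne_top N) hQ) (hμ.measure_ball_ne_top x one_pos)) h)
  rw [ae_restrict_iff' measurableSet_ball, ae_iff] at h2
  refine measure_mono_null ?_ h2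
  rintro y ⟨hy, hyx⟩ hcon
  exact hy (hcon hyx).ne

/-- The functions `W m` converge almost everywhere as the scale `16 ^ (-m)` tends to `0`. -/
lemma exists_limit (hW : IsScaleFamily μ c M Q E W) (hμ : IsDoublingWith μ c) (hQ : Q ≠ ∞) :
    ∃ f : Fin N → X → ℝ, (∀ j x, 0 ≤ f j x) ∧ (∀ x, ∑ j, f j x = M) ∧
      ∀ᵐ x ∂μ, ∀ j, Tendsto (fun i : ℕ => W i j x) atTop (𝓝 (f j x)) := by
  have hex : ∀ x, ∃ w : Fin N → ℝ, (∀ j, 0 ≤ w j) ∧ ∑ j, w j = M ∧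
      ((∀ j, ∃ w', Tendsto (fun i : ℕ => W i j x) atTop (𝓝 w')) →
        ∀ j, Tendsto (fun i : ℕ => W i j x) atTop (𝓝 (w j))) := by
    intro x
    by_cases h : ∀ j, ∃ w', Tendsto (fun i : ℕ => W i j x) atTop (𝓝 w')
    · choose w hw using h
      refine ⟨w, fun j => ge_of_tendsto' (hw j) fun i => hW.nonneg _ _ _, ?_, fun _ => hw⟩
      refine tendsto_nhds_unique (tendsto_finsetSum _ fun j _ => hw j) ?_
      simp only [hW.sum_eq]
      exact tendsto_const_nhds
    · exact ⟨fun j => W 0 j x, fun j => hW.nonneg _ _ _, hW.sum_eq 0 x, fun h' => absurd h' h⟩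
  choose w hw0 hwM hw using hex
  refine ⟨fun j x => w x j, fun j x => hw0 x j, hwM, ?_⟩
  filter_upwards [ae_all_iff.2 fun j => hW.ae_tsum_ne_top hμ hQ j] with x hx
  refine hw x fun j => cauchySeq_tendsto_of_complete ?_
  refine cauchySeq_of_edist_le_of_tsum_ne_top _ (fun i => ?_) (hx j)
  rw [edist_comm, edist_eq_enorm_sub]
  push_cast
  exact le_rfl

lemma setLIntegral_sub_limit_le (hW : IsScaleFamily μ c M Q E W) {f : Fin N → X → ℝ}
    (hf : ∀ᵐ x ∂μ, ∀ j, Tendsto (fun i : ℕ => W i j x) atTop (𝓝 (f j x)))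
    (m : ℤ) (j : Fin N) (z : X) :
    ∫⁻ x in ball z (16 ^ (-m)), ‖f j x - W m j x‖ₑ ∂μ ≤ N * Q * μ (ball z (16 ^ (-m))) := by
  refine (lintegral_mono_ae (ae_restrict_of_ae ?_)).trans (hW.setLIntegral_tsum_le m j z)
  filter_upwards [hf] with x hx
  have hlim : Tendsto (fun i : ℕ => W (m + i) j x) atTop (𝓝 (f j x)) := by
    have h1 : Tendsto (fun i : ℕ => (m + i).toNat) atTop atTop := by
      refine tendsto_atTop.2 fun b => ?_
      filter_upwards [eventually_ge_atTop (b + (-m).toNat)] with i hi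
      omega
    refine ((hx j).comp h1).congr' ?_
    filter_upwards [eventually_ge_atTop (-m).toNat] with i hi
    simp only [Function.comp]
    congr 1
    omega
  have h := edist_le_tsum_of_edist_le_of_tendsto (f := fun i : ℕ => W (m + i) j x)
    (fun i : ℕ => ‖W (m + i + 1) j x - W (m + i) j x‖ₑ) (fun i => ?_) hlim 0
  · rw [edist_comm, edist_eq_enorm_sub] at h
    simpa using h
  · rw [edist_comm, edist_eq_enorm_sub]
    push_cast
    rw [add_assoc]

lemma ae_limit_le (hW : IsScaleFamily μ c M Q E W) (hμ : IsDoublingWith μ c) {f : Fin N → X → ℝ}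
    (hf : ∀ᵐ x ∂μ, ∀ j, Tendsto (fun i : ℕ => W i j x) atTop (𝓝 (f j x))) (j : Fin N) :
    ∀ᵐ x ∂μ, x ∈ E j → f j x ≤ stepLip N + 2 := by
  have hc := hμ.one_lt
  filter_upwards [hf, hμ.ae_eventually_le_measure_inter_ball (E j)] with x hx hd hxE
  have hlim : Tendsto (fun i : ℕ => (8 : ℝ) * 16 ^ (-(i : ℤ))) atTop (𝓝[>] 0) := by
    refine tendsto_nhdsWithin_iff.2 ⟨?_, Eventually.of_forall fun i => ?_⟩
    · have h : Tendsto (fun i : ℕ => (8 : ℝ) * (16⁻¹) ^ i) atTop (𝓝 (8 * 0)) :=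
        (tendsto_pow_atTop_nhds_zero_of_lt_one (by norm_num) (by norm_num)).const_mul 8
      simpa [zpow_neg, inv_pow] using h
    · rw [mem_Ioi]; positivity
  refine le_of_tendsto (hx j) ?_
  filter_upwards [hlim.eventually (hd hxE)] with i hi
  have hr : (0 : ℝ) < 8 * 16 ^ (-(i : ℤ)) := by positivity
  have h2 := hi.trans (hW.density i j x)
  rw [ENNReal.mul_le_mul_iff_left (hμ.measure_ball_ne_zero x hr) (hμ.measure_ball_ne_top x hr),
    epow.le_iff hc] at h2
  linarith

end IsScaleFamily

/-- Subtract `b`, keep the positive part, and normalize the sum to be `1`. -/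
noncomputable def truncNormalize (b : ℝ) (v : Fin N → ℝ) (j : Fin N) : ℝ :=
  max (v j - b) 0 / ∑ i, max (v i - b) 0

lemma half_le_sum_max {b : ℝ} (hb : 2 * N * b ≤ M) {v : Fin N → ℝ} (hv : ∑ i, v i = M) :
    M / 2 ≤ ∑ i, max (v i - b) 0 := by
  calc M / 2 ≤ M - N * b := by linarith
    _ = ∑ i, (v i - b) := by
        rw [Finset.sum_sub_distrib, hv, Finset.sum_const, Finset.card_univ, Fintype.card_fin,
          nsmul_eq_mul]
    _ ≤ _ := Finset.sum_le_sum fun i _ => le_max_left _ _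

lemma truncNormalize_nonneg (b : ℝ) (v : Fin N → ℝ) (j : Fin N) : 0 ≤ truncNormalize b v j :=
  div_nonneg (le_max_right _ _) (Finset.sum_nonneg fun _ _ => le_max_right _ _)

lemma truncNormalize_le_one (b : ℝ) (v : Fin N → ℝ) (j : Fin N) : truncNormalize b v j ≤ 1 :=
  div_le_one_of_le₀ (Finset.single_le_sum (f := fun i => max (v i - b) 0)
    (fun _ _ => le_max_right _ _) (Finset.mem_univ j))
    (Finset.sum_nonneg fun _ _ => le_max_right _ _)

lemma sum_truncNormalize {b : ℝ} (hM : 0 < M) (hb : 2 * N * b ≤ M) {v : Fin N → ℝ}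
    (hv : ∑ i, v i = M) : ∑ j, truncNormalize b v j = 1 := by
  have := half_le_sum_max hb hv
  simp only [truncNormalize]
  rw [← Finset.sum_div, div_self (by linarith)]

lemma truncNormalize_eq_zero {b : ℝ} {v : Fin N → ℝ} {j : Fin N} (h : v j ≤ b) :
    truncNormalize b v j = 0 := by
  rw [truncNormalize, max_eq_right (by linarith), zero_div]

lemma abs_truncNormalize_sub_le {b : ℝ} (hM : 0 < M) (hb : 2 * N * b ≤ M) {u v : Fin N → ℝ}
    (hu : ∑ i, u i = M) (hv : ∑ i, v i = M) (j : Fin N) :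
    |truncNormalize b u j - truncNormalize b v j| ≤ 4 / M * ∑ i, |u i - v i| := by
  set g : (Fin N → ℝ) → Fin N → ℝ := fun w i => max (w i - b) 0
  have hSu : M / 2 ≤ ∑ i, g u i := half_le_sum_max hb hu
  have hSv : M / 2 ≤ ∑ i, g v i := half_le_sum_max hb hv
  have hgi : ∀ i, |g u i - g v i| ≤ |u i - v i| := fun i => by
    have h := abs_max_sub_max_le_abs (u i - b) (v i - b) 0
    rwa [sub_sub_sub_cancel_right] at h
  have hj : |g u j - g v j| ≤ ∑ i, |u i - v i| := (hgi j).trans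
    (Finset.single_le_sum (f := fun i => |u i - v i|) (fun _ _ => abs_nonneg _) (Finset.mem_univ j))
  have hS : |∑ i, g v i - ∑ i, g u i| ≤ ∑ i, |u i - v i| := by
    rw [← Finset.sum_sub_distrib]
    refine (Finset.abs_sum_le_sum_abs _ _).trans (Finset.sum_le_sum fun i _ => ?_)
    rw [abs_sub_comm]; exact hgi i
  have h0 := truncNormalize_nonneg b v j
  have h1 := truncNormalize_le_one b v j
  have e : truncNormalize b u j - truncNormalize b v j =
      ((g u j - g v j) + truncNormalize b v j * ((∑ i, g v i) - ∑ i, g u i)) / ∑ i, g u i := by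
    have hSu0 : ∑ i, g u i ≠ 0 := by linarith
    have hSv0 : ∑ i, g v i ≠ 0 := by linarith
    change g u j / (∑ i, g u i) - g v j / (∑ i, g v i) =
      ((g u j - g v j) + g v j / (∑ i, g v i) * ((∑ i, g v i) - ∑ i, g u i)) / ∑ i, g u i
    field_simp
    ring
  rw [e, abs_div, abs_of_pos (by linarith : 0 < ∑ i, g u i), div_le_iff₀ (by linarith)]
  calc _ ≤ |g u j - g v j| + |truncNormalize b v j * (∑ i, g v i - ∑ i, g u i)| := abs_add_le _ _
    _ ≤ ∑ i, |u i - v i| + 1 * ∑ i, |u i - v i| := by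
        rw [abs_mul, abs_of_nonneg h0]
        gcongr
    _ = 4 / M * (∑ i, |u i - v i|) * (M / 2) := by field_simp; ring
    _ ≤ _ := by gcongr

/-- To bound the BMO norm it suffices to bound the mean distance to some constant, on every ball. -/
lemma bmoNorm_le_of_forall_exists (hμ : IsDoublingWith μ c) {f : X → ℝ} {A : ℝ≥0∞}
    (hf : ∀ (x : X) (r : ℝ), 0 < r → IntegrableOn f (ball x r) μ)
    (h : ∀ (x : X) (r : ℝ), 0 < r →
      ∃ a : ℝ, ∫⁻ y in ball x r, ‖f y - a‖ₑ ∂μ ≤ A * μ (ball x r)) :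
    bmoNorm μ f ≤ 2 * A := by
  refine iSup₂_le fun x r => iSup_le fun hr => ?_
  obtain ⟨a, ha⟩ := h x r hr
  have h0 := hμ.measure_ball_ne_zero x hr
  have htop := hμ.measure_ball_ne_top x hr
  have hpos := hμ.measureReal_ball_pos x hr
  have hfB := hf x r hr
  set B := ball x r
  rw [setLAverage_eq, ENNReal.div_le_iff h0 htop]
  have e : (⨍ z in B, f z ∂μ) - a = (μ.real B)⁻¹ * ∫ z in B, (f z - a) ∂μ := by
    rw [integral_sub hfB (integrableOn_const (C := a) htop), setAverage_eq,
      setIntegral_const, smul_eq_mul, smul_eq_mul]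
    field_simp
  have hav : ‖(⨍ z in B, f z ∂μ) - a‖ₑ ≤ A := by
    rw [e, enorm_mul]
    have h1 : ‖∫ z in B, (f z - a) ∂μ‖ₑ ≤ A * μ B := (enorm_integral_le_lintegral_enorm _).trans ha
    have h2 : ‖(μ.real B)⁻¹‖ₑ = (μ B)⁻¹ := by
      rw [Real.enorm_eq_ofReal (by positivity), ENNReal.ofReal_inv_of_pos hpos, Measure.real,
        ENNReal.ofReal_toReal htop]
    rw [h2]
    calc (μ B)⁻¹ * _ ≤ (μ B)⁻¹ * (A * μ B) := by gcongr
      _ = A * ((μ B)⁻¹ * μ B) := by ring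
      _ = A := by rw [ENNReal.inv_mul_cancel h0 htop, mul_one]
  calc ∫⁻ y in B, ‖f y - ⨍ z in B, f z ∂μ‖ₑ ∂μ ≤ ∫⁻ y in B, (‖f y - a‖ₑ + A) ∂μ := by
        refine lintegral_mono fun y => ?_
        have : f y - ⨍ z in B, f z ∂μ = (f y - a) - ((⨍ z in B, f z ∂μ) - a) := by ring
        rw [this]
        exact (enorm_sub_le).trans (by gcongr)
    _ = ∫⁻ y in B, ‖f y - a‖ₑ ∂μ + A * μ B := by
        rw [lintegral_add_right _ measurable_const, setLIntegral_const]
    _ ≤ A * μ B + A * μ B := by gcongr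
    _ = _ := by ring

lemma memBMO_of_bounded (hμ : IsDoublingWith μ c) {f : X → ℝ} (hf : AEStronglyMeasurable f μ)
    (h0 : ∀ x, 0 ≤ f x) (h1 : ∀ x, f x ≤ 1) {A : ℝ} (hA : bmoNorm μ f ≤ ENNReal.ofReal A) :
    MemBMO μ f :=
  ⟨fun x => ⟨ball x 1, ball_mem_nhds x one_pos,
    hμ.integrableOn_ball hf h0 h1 x one_pos⟩, hA.trans_lt ENNReal.ofReal_lt_top⟩

variable [BorelSpace X]

/-- The main case of the existence statement: the functions obtained from a scale family by
truncation and normalization. -/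
lemma IsScaleFamily.exists_partition (hW : IsScaleFamily μ c M Q E W) (hμ : IsDoublingWith μ c)
    (hQ : Q ≠ ∞) (hM : 0 < M) (hb : 2 * N * (stepLip N + 2) ≤ M) :
    ∃ f : Fin N → X → ℝ, IsPartitionVanishingOn μ E f ∧ ∀ j, AEStronglyMeasurable (f j) μ ∧
      bmoNorm μ (f j) ≤ 2 * (ENNReal.ofReal (4 / M) * (N * (N * Q + ENNReal.ofReal (stepLip N))) *
        epow c 4) := by
  have hc := hμ.one_lt
  have hL := stepLip_pos N
  obtain ⟨g, hg0, hgM, hg⟩ := hW.exists_limit hμ hQ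
  set b := stepLip N + 2
  have hgm : ∀ j, AEMeasurable (g j) μ := fun j =>
    aemeasurable_of_tendsto_metrizable_ae atTop
      (fun i : ℕ => (hW.continuous i j).measurable.aemeasurable)
      (by filter_upwards [hg] with x hx using hx j)
  set f : Fin N → X → ℝ := fun j x => truncNormalize b (fun i => g i x) j
  have hfm : ∀ j, AEStronglyMeasurable (f j) μ := fun j =>
    (((hgm j).sub_const b).max aemeasurable_const |>.div
      (Finset.aemeasurable_fun_sum _ fun i _ =>
        ((hgm i).sub_const b).max aemeasurable_const)).aestronglyMeasurable
  refine ⟨f, ⟨fun x => sum_truncNormalize hM hb (hgM x), fun j x => truncNormalize_nonneg _ _ _,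
    fun j x => truncNormalize_le_one _ _ _, fun j => ?_⟩, fun j => ⟨hfm j, ?_⟩⟩
  · filter_upwards [hW.ae_limit_le hμ hg j] with x hx hxE
    exact truncNormalize_eq_zero (hx hxE)
  refine bmoNorm_le_of_forall_exists hμ (fun x r hr => hμ.integrableOn_ball (hfm j)
    (fun x => truncNormalize_nonneg _ _ _) (fun x => truncNormalize_le_one _ _ _) x hr)
    fun z r hr => ?_
  -- compare with the value at the centre of the function at the scale of the ball
  obtain ⟨n, hn1, hn2⟩ := exists_mem_Ioc_zpow hr (by norm_num : (1 : ℝ) < 16)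
  obtain ⟨m, rfl⟩ : ∃ m : ℤ, n = -m - 1 := ⟨-n - 1, by ring⟩
  rw [sub_add_cancel] at hn2
  have h16 : (16 : ℝ) ^ (-m) = 16 * 16 ^ (-m - 1) := by
    rw [zpow_sub_one₀ (by norm_num)]; ring
  have hr16 : (16 : ℝ) ^ (-m) ≤ 16 * r := by rw [h16]; linarith
  set s : ℝ := 16 ^ (-m)
  have hs0 : 0 < s := by positivity
  refine ⟨truncNormalize b (fun i => W m i z) j, ?_⟩
  have hpt : ∀ x ∈ ball z s, ‖f j x - truncNormalize b (fun i => W m i z) j‖ₑ ≤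
      ENNReal.ofReal (4 / M) *
        ∑ i, (‖g i x - W m i x‖ₑ + ENNReal.ofReal (stepLip N)) := by
    intro x hx
    rw [mem_ball] at hx
    have h1 := abs_truncNormalize_sub_le hM hb (hgM x) (hW.sum_eq m z) j
    have h2 : ∑ i, |g i x - W m i z| ≤ ∑ i, (|g i x - W m i x| + stepLip N) := by
      refine Finset.sum_le_sum fun i _ => ?_
      have h3 : stepLip N / s * dist x z ≤ stepLip N := by
        rw [div_mul_eq_mul_div, div_le_iff₀ hs0]
        gcongr
      have h4 := hW.lip m i x z
      have h5 := abs_sub_le (g i x) (W m i x) (W m i z)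
      linarith
    rw [← ofReal_norm, Real.norm_eq_abs]
    refine (ENNReal.ofReal_le_ofReal (h1.trans (mul_le_mul_of_nonneg_left h2
      (by positivity)))).trans_eq ?_
    rw [ENNReal.ofReal_mul (by positivity), ENNReal.ofReal_sum_of_nonneg fun i _ => by positivity]
    congr 1
    refine Finset.sum_congr rfl fun i _ => ?_
    rw [ENNReal.ofReal_add (abs_nonneg _) hL.le, ← ofReal_norm, Real.norm_eq_abs]
  have hmeas : ∀ i, AEMeasurable (fun x => ‖g i x - W m i x‖ₑ) (μ.restrict (ball z s)) := fun i =>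
    ((hgm i).sub (hW.continuous m i).measurable.aemeasurable).enorm.restrict
  calc ∫⁻ x in ball z r, ‖f j x - truncNormalize b (fun i => W m i z) j‖ₑ ∂μ
      ≤ ∫⁻ x in ball z s, ‖f j x - truncNormalize b (fun i => W m i z) j‖ₑ ∂μ :=
        lintegral_mono_set (ball_subset_ball hn2)
    _ ≤ ∫⁻ x in ball z s, ENNReal.ofReal (4 / M) *
          ∑ i, (‖g i x - W m i x‖ₑ + ENNReal.ofReal (stepLip N)) ∂μ :=
        setLIntegral_mono' measurableSet_ball hpt
    _ = ENNReal.ofReal (4 / M) * ∑ i, (∫⁻ x in ball z s, ‖g i x - W m i x‖ₑ ∂μ +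
          ENNReal.ofReal (stepLip N) * μ (ball z s)) := by
        rw [lintegral_const_mul' _ _ ENNReal.ofReal_ne_top,
          lintegral_finsetSum' (f := fun i x => ‖g i x - W m i x‖ₑ + ENNReal.ofReal (stepLip N)) _
            fun i _ => (hmeas i).add aemeasurable_const]
        congr 1
        refine Finset.sum_congr rfl fun i _ => ?_
        rw [lintegral_add_right _ measurable_const, setLIntegral_const]
    _ ≤ ENNReal.ofReal (4 / M) * ∑ _i : Fin N, (N * Q * μ (ball z s) +
          ENNReal.ofReal (stepLip N) * μ (ball z s)) := by
        gcongr with i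
        exact hW.setLIntegral_sub_limit_le hg m i z
    _ = ENNReal.ofReal (4 / M) * (N * (N * Q + ENNReal.ofReal (stepLip N))) * μ (ball z s) := by
        rw [Finset.sum_const, Finset.card_univ, Fintype.card_fin, nsmul_eq_mul]
        ring
    _ ≤ ENNReal.ofReal (4 / M) * (N * (N * Q + ENNReal.ofReal (stepLip N))) *
          (epow c 4 * μ (ball z r)) := by
        gcongr
        exact hμ.measure_ball_le hr 3 4 (by norm_num; exact hr16) (by rw [dist_self]; positivity)
    _ = _ := by ring

end

/-! ### The two implications -/

namespace DensityCondition

variable {X : Type*} [MetricSpace X] [MeasurableSpace X] {N : ℕ}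
  {μ : Measure X} {c lam : ℝ} {E : Fin N → Set X}

lemma exists_measure_inter_ball_le (h : DensityCondition μ c lam E) (hμ : IsDoublingWith μ c)
    (hN : 2 ≤ N) (x : X) (r : ℝ) (hr : 0 < r) :
    ∃ j, μ (E j ∩ ball x r) ≤ epow c (-(4 * lam)) * μ (ball x r) := by
  have hc := hμ.one_lt
  have : Nonempty (Fin N) := ⟨⟨0, by omega⟩⟩
  obtain ⟨j, hj⟩ := exists_eq_ciInf_of_finite
    (f := fun j : Fin N => μ.real (E j ∩ ball x r) / μ.real (ball x r))
  have h1 := h x r hr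
  rw [← hj, div_le_iff₀ (hμ.measureReal_ball_pos x hr)] at h1
  have htop := hμ.measure_ball_ne_top x hr
  refine ⟨j, ?_⟩
  rw [← ENNReal.ofReal_toReal (measure_ne_top_of_subset inter_subset_right htop),
    ← ENNReal.ofReal_toReal htop, epow, ← ENNReal.ofReal_mul (Real.rpow_nonneg (by linarith) _),
    ← neg_mul]
  exact ENNReal.ofReal_le_ofReal h1

variable [BorelSpace X]

/-- At a density point of the intersection all the sets would be dense in small balls. -/
lemma measure_iInter_eq_zero (h : DensityCondition μ c lam E) (hμ : IsDoublingWith μ c)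
    (hN : 2 ≤ N) (hlam : 1 < lam) : μ (⋂ j, E j) = 0 := by
  have hc := hμ.one_lt
  rw [measure_eq_zero_iff_ae_notMem]
  filter_upwards [hμ.ae_eventually_le_measure_inter_ball (⋂ j, E j)] with x hx hxE
  obtain ⟨r, hr, hr0⟩ := ((hx hxE).and self_mem_nhdsWithin).exists
  obtain ⟨j, hj⟩ := h.exists_measure_inter_ball_le hμ hN x r hr0
  have h1 := hr.trans ((measure_mono (inter_subset_inter_left _ (iInter_subset _ j))).trans hj)
  rw [ENNReal.mul_le_mul_iff_left (hμ.measure_ball_ne_zero x hr0) (hμ.measure_ball_ne_top x hr0),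
    epow.le_iff hc] at h1
  linarith

/-- A partition into indicator functions, with BMO norm at most `2`. It settles the existence
statement for bounded values of the parameter. -/
lemma exists_indicator_partition (h : DensityCondition μ c lam E) (hμ : IsDoublingWith μ c)
    (hN : 2 ≤ N) (hlam : 1 < lam) (hE : ∀ j, NullMeasurableSet (E j) μ) :
    ∃ f : Fin N → X → ℝ, IsPartitionVanishingOn μ E f ∧ ∀ j, AEStronglyMeasurable (f j) μ ∧
      bmoNorm μ (f j) ≤ 2 := by
  classical
  set j₀ : Fin N := ⟨0, by omega⟩
  have hsel : ∀ x, ∃ j, (x ∉ E j ∧ ∀ i < j, x ∈ E i) ∨ (j = j₀ ∧ ∀ i, x ∈ E i) := by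
    intro x
    by_cases hx : ∃ j, x ∉ E j
    · obtain ⟨j, hj, hmin⟩ := wellFounded_lt.has_min {j | x ∉ E j} hx
      exact ⟨j, Or.inl ⟨hj, fun i hi => by
        by_contra hc
        exact hmin i hc hi⟩⟩
    · push Not at hx
      exact ⟨j₀, Or.inr ⟨rfl, hx⟩⟩
  choose sel hsel using hsel
  have huniq : ∀ x j, (sel x = j ↔ (x ∉ E j ∧ ∀ i < j, x ∈ E i) ∨ (j = j₀ ∧ ∀ i, x ∈ E i)) := by
    intro x j
    constructor
    · rintro rfl; exact hsel x
    · intro hj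
      rcases hsel x with h1 | h1 <;> rcases hj with h2 | h2
      · rcases lt_trichotomy (sel x) j with h3 | h3 | h3
        · exact absurd (h2.2 _ h3) h1.1
        · exact h3
        · exact absurd (h1.2 _ h3) h2.1
      · exact absurd (h2.2 _) h1.1
      · exact absurd (h1.2 _) h2.1
      · rw [h1.1, h2.1]
  have hmeas : ∀ j, NullMeasurableSet {x | sel x = j} μ := by
    intro j
    have e : {x | sel x = j} = ((E j)ᶜ ∩ ⋂ i, ⋂ (_ : i < j), E i) ∪
        (if j = j₀ then ⋂ i, E i else ∅) := by
      ext x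
      rw [mem_ofPred_eq, huniq]
      split_ifs with hj <;> simp [hj]
    rw [e]
    refine ((hE j).compl.inter (NullMeasurableSet.iInter fun i =>
      NullMeasurableSet.iInter fun _ => hE i)).union ?_
    split_ifs
    · exact NullMeasurableSet.iInter hE
    · exact MeasurableSet.empty.nullMeasurableSet
  set f : Fin N → X → ℝ := fun j => {x | sel x = j}.indicator fun _ => 1 with hf
  have hf0 : ∀ j x, 0 ≤ f j x := fun j x => indicator_nonneg (fun _ _ => zero_le_one) x
  have hf1 : ∀ j x, f j x ≤ 1 := fun j x => indicator_le_self' (fun _ _ => zero_le_one) x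
  have hfm : ∀ j, AEStronglyMeasurable (f j) μ := fun j =>
    aestronglyMeasurable_const.indicator₀ (hmeas j)
  refine ⟨f, ⟨fun x => ?_, hf0, hf1, fun j => ?_⟩, fun j => ⟨hfm j, ?_⟩⟩
  · simp [hf, indicator_apply]
  · filter_upwards [measure_eq_zero_iff_ae_notMem.1 (h.measure_iInter_eq_zero hμ hN hlam)]
      with x hx hxj
    refine indicator_of_notMem (fun hs => ?_) _
    rcases (huniq x j).1 hs with h1 | h1
    · exact h1.1 hxj
    · exact hx (mem_iInter.2 h1.2)
  · refine le_of_le_of_eq (bmoNorm_le_of_forall_exists (A := 1) hμ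
      (fun x r hr => hμ.integrableOn_ball (hfm j) (hf0 j) (hf1 j) x hr)
      fun x r hr => ⟨0, ?_⟩) (mul_one 2)
    rw [one_mul]
    refine (lintegral_mono fun y => ?_).trans_eq (setLIntegral_one _)
    rw [sub_zero, ← ofReal_norm, Real.norm_eq_abs, abs_of_nonneg (hf0 j y)]
    exact ENNReal.ofReal_le_one.2 (hf1 j y)

end DensityCondition

lemma one_sub_epow_inv_ne_top {c : ℝ} (hc : 1 < c) : (1 - epow c (-4))⁻¹ ≠ ∞ := by
  rw [ENNReal.inv_ne_top]
  refine (tsub_pos_of_lt ?_).ne'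
  rw [← epow.zero c, epow.lt_iff hc]
  norm_num

/-- For large `M` the packing inequality has a solution `Q` independent of `M`. -/
lemma exists_packing_constant {c : ℝ} (hc : 1 < c) (N : ℕ) :
    ∃ Q : ℝ≥0∞, Q ≠ ∞ ∧ ∃ M₀ : ℝ, 0 ≤ M₀ ∧ ∀ M, M₀ ≤ M →
      N * (epow c 5 * (epow c (12 * stepLip N + 6) * (1 - epow c (-4))⁻¹ +
        epow c (6 - 4 * M) * (1 - epow c (-4))⁻¹ * ((1 + Q * epow c 3) * epow c 2))) ≤ Q := by
  set G := (1 - epow c (-4))⁻¹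
  have hG : G ≠ ∞ := one_sub_epow_inv_ne_top hc
  set P := N * (epow c 5 * (epow c (12 * stepLip N + 6) * G)) with hP
  have hPtop : P ≠ ∞ := ENNReal.mul_ne_top (ENNReal.natCast_ne_top N)
    (ENNReal.mul_ne_top (epow.ne_top _ _) (ENNReal.mul_ne_top (epow.ne_top _ _) hG))
  set S := 2 * (N * (epow c 16 * G)) with hS
  have hStop : S ≠ ∞ := ENNReal.mul_ne_top ENNReal.ofNat_ne_top
    (ENNReal.mul_ne_top (ENNReal.natCast_ne_top N) (ENNReal.mul_ne_top (epow.ne_top _ _) hG))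
  obtain ⟨n, hn⟩ := pow_unbounded_of_one_lt S.toReal hc
  refine ⟨2 * P + 1, ENNReal.add_ne_top.2 ⟨ENNReal.mul_ne_top ENNReal.ofNat_ne_top hPtop,
    ENNReal.one_ne_top⟩, n, Nat.cast_nonneg n, fun M hM => ?_⟩
  have hη : S * epow c (-(4 * M)) ≤ 1 := by
    have h1 : S ≤ epow c (4 * M) := by
      rw [← ENNReal.ofReal_toReal hStop]
      have h2 : epow c n ≤ epow c (4 * M) :=
        epow.mono hc (by have : (0 : ℝ) ≤ n := Nat.cast_nonneg n; linarith)
      refine le_trans (ENNReal.ofReal_le_ofReal ?_) h2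
      rw [Real.rpow_natCast]
      exact hn.le
    calc S * epow c (-(4 * M)) ≤ epow c (4 * M) * epow c (-(4 * M)) := by gcongr
      _ = 1 := epow.mul_neg_cancel hc _
  -- twice the last summand, with the exponents collected
  have hlast : 2 * (N * (epow c 5 * (epow c (6 - 4 * M) * G *
      ((1 + (2 * P + 1) * epow c 3) * epow c 2)))) ≤ 1 + (2 * P + 1) := by
    have e6 : epow c (6 - 4 * M) = epow c 6 * epow c (-(4 * M)) := by
      rw [← epow.add hc, sub_eq_add_neg]
    have e16 : epow c 16 = epow c 5 * epow c 6 * epow c 2 * epow c 3 := by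
      rw [← epow.add hc, ← epow.add hc, ← epow.add hc]; norm_num
    have h3 : 1 ≤ epow c 3 := epow.one_le hc (by norm_num)
    calc 2 * (N * (epow c 5 * (epow c (6 - 4 * M) * G *
          ((1 + (2 * P + 1) * epow c 3) * epow c 2))))
        ≤ 2 * (N * (epow c 5 * (epow c (6 - 4 * M) * G *
          ((epow c 3 + (2 * P + 1) * epow c 3) * epow c 2)))) := by gcongr
      _ = S * epow c (-(4 * M)) * (1 + (2 * P + 1)) := by
          rw [e6, hS, e16]; ring
      _ ≤ 1 * (1 + (2 * P + 1)) := by gcongr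
      _ = _ := one_mul _
  have h2 : 2 * (N * (epow c 5 * (epow c (12 * stepLip N + 6) * G +
      epow c (6 - 4 * M) * G * ((1 + (2 * P + 1) * epow c 3) * epow c 2)))) ≤
      2 * (2 * P + 1) := by
    calc _ = 2 * P + 2 * (N * (epow c 5 * (epow c (6 - 4 * M) * G *
          ((1 + (2 * P + 1) * epow c 3) * epow c 2)))) := by rw [hP]; ring
      _ ≤ 2 * P + (1 + (2 * P + 1)) := by gcongr
      _ = 2 * (2 * P + 1) := by ring
  exact (ENNReal.mul_le_mul_iff_right (by norm_num) (by norm_num)).1 h2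

theorem theorem2p1 (cD : ℝ) (hcD : 1 < cD) (N : ℕ) (hN : 2 ≤ N) :
    (∃ c₁ : ℝ, 0 < c₁ ∧
      ∀ (X : Type*) [MetricSpace X] [CompleteSpace X] [MeasurableSpace X] [BorelSpace X]
        (μ : Measure X), IsDoublingWith μ cD →
      ∀ (lam : ℝ), 1 < lam →
      ∀ (E : Fin N → Set X), (∀ j, NullMeasurableSet (E j) μ) →
        DensityCondition μ cD lam E →
        ∃ f : Fin N → X → ℝ, IsPartitionVanishingOn μ E f ∧
          ∀ j, MemBMO μ (f j) ∧ bmoNorm μ (f j) ≤ ENNReal.ofReal (c₁ / lam)) ∧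
    (∃ c₂ : ℝ, 0 < c₂ ∧
      ∀ (X : Type*) [MetricSpace X] [CompleteSpace X] [MeasurableSpace X] [BorelSpace X]
        (μ : Measure X), IsDoublingWith μ cD →
      ∀ (lam : ℝ), 1 < lam →
      ∀ (E : Fin N → Set X), (∀ j, NullMeasurableSet (E j) μ) →
        (∃ f : Fin N → X → ℝ, IsPartitionVanishingOn μ E f ∧
          ∀ j, MemBMO μ (f j) ∧ bmoNorm μ (f j) ≤ ENNReal.ofReal (c₂ / lam)) →
        DensityCondition μ cD lam E) := by
  constructor
  · obtain ⟨Q, hQ, M₀, hM₀, hpack⟩ := exists_packing_constant hcD N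
    have hL := stepLip_pos N
    set A : ℝ≥0∞ := N * (N * Q + ENNReal.ofReal (stepLip N)) * epow cD 4 with hA
    have hAtop : A ≠ ∞ := ENNReal.mul_ne_top (ENNReal.mul_ne_top (ENNReal.natCast_ne_top N)
      (ENNReal.add_ne_top.2 ⟨ENNReal.mul_ne_top (ENNReal.natCast_ne_top N) hQ,
        ENNReal.ofReal_ne_top⟩)) (epow.ne_top _ _)
    set lam₀ := 2 * (M₀ + 2 * N * (stepLip N + 2)) + 1
    have hlam₀_pos : 0 < lam₀ := by positivity
    refine ⟨16 * A.toReal + 2 * lam₀, by positivity, ?_⟩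
    intro X _ _ _ _ μ hμ lam hlam E hE hdens
    have hlam0 : 0 < lam := by linarith
    suffices h : ∃ f : Fin N → X → ℝ, IsPartitionVanishingOn μ E f ∧
        ∀ j, AEStronglyMeasurable (f j) μ ∧
          bmoNorm μ (f j) ≤ ENNReal.ofReal ((16 * A.toReal + 2 * lam₀) / lam) by
      obtain ⟨f, hf, hfj⟩ := h
      exact ⟨f, hf, fun j => ⟨memBMO_of_bounded hμ (hfj j).1 (hf.nonneg j) (hf.le_one j) (hfj j).2,
        (hfj j).2⟩⟩
    rcases lt_or_ge lam lam₀ with hsmall | hlarge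
    · obtain ⟨f, hf, hfj⟩ := hdens.exists_indicator_partition hμ hN hlam hE
      refine ⟨f, hf, fun j => ⟨(hfj j).1, (hfj j).2.trans ?_⟩⟩
      rw [← ENNReal.ofReal_ofNat 2]
      refine ENNReal.ofReal_le_ofReal ?_
      rw [le_div_iff₀ hlam0]
      have : 0 ≤ A.toReal := ENNReal.toReal_nonneg
      linarith
    · have hN0 : (0 : ℝ) ≤ N := Nat.cast_nonneg N
      have hNL : 0 ≤ 2 * N * (stepLip N + 2) := by positivity
      have hM : 0 < lam / 2 := by positivity
      obtain ⟨W, hW⟩ := exists_isScaleFamily (M := lam / 2) hμ hM (fun x r hr => by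
        obtain ⟨j, hj⟩ := hdens.exists_measure_inter_ball_le hμ hN x r hr
        exact ⟨j, by rwa [show 8 * (lam / 2) = 4 * lam by ring]⟩) (hpack _ (by linarith))
      obtain ⟨f, hf, hfj⟩ := hW.exists_partition hμ hQ hM (by linarith)
      refine ⟨f, hf, fun j => ⟨(hfj j).1, (hfj j).2.trans ?_⟩⟩
      have hA2 : 2 * (ENNReal.ofReal (4 / (lam / 2)) * A) =
          ENNReal.ofReal (2 * (4 / (lam / 2) * A.toReal)) := by
        rw [ENNReal.ofReal_mul (by norm_num), ENNReal.ofReal_mul (by positivity),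
          ENNReal.ofReal_toReal hAtop, ENNReal.ofReal_ofNat]
      rw [mul_assoc (ENNReal.ofReal _), ← hA, hA2]
      refine ENNReal.ofReal_le_ofReal ?_
      rw [show 2 * (4 / (lam / 2) * A.toReal) = 16 * A.toReal / lam by field_simp; ring]
      gcongr
      linarith
  · have hD0 : 0 < 2 * (cD ^ 8 + 2 * cD + cD ^ 2) := by positivity
    have hN0 : (0 : ℝ) < N := by exact_mod_cast (by omega : 0 < N)
    refine ⟨(5 * (2 * (cD ^ 8 + 2 * cD + cD ^ 2)) * N)⁻¹, by positivity, ?_⟩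
    intro X _ _ _ _ μ hμ lam hlam E _ hf
    obtain ⟨f, hf, hfj⟩ := hf
    exact hμ.densityCondition_of_partition hN rfl hlam hf (fun j => (hfj j).1.1) fun j => (hfj j).2
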